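/- Let $\mathcal M=\{1,\dots,m\}$, let $\mathcal X_i,\mathcal Y_i$ ($i\in\mathcal M$) be finite alphabets, let $A,B\subseteq\mathcal M$ (sampling set and recovery set), and let $d:\mathcal X_B\times\mathcal Y_B\to[0,\infty)$, where $\mathcal X_B=\prod_{i\in B}\mathcal X_i$, and similarly for $\mathcal X_A$, $\mathcal Y_B$. Let $\Theta$ be a finite nonempty set and $\{P_{X_{\mathcal M}|\theta=\tau},\ \tau\in\Theta\}$ a family of pmfs on $\mathcal X_{\mathcal M}$ with full support. Given $\theta=\tau$, the source $X_{\mathcal M1},X_{\mathcal M2},\dots$ is i.i.d. with pmf $P_{X_{\mathcal M}|\theta=\tau}$. In the Bayesian setting $\theta$ has a known pmf $\mu_\theta$ of full support; in the nonBayesian setting $\theta$ is an unknown constant. An $n$-length code with fixed-set sampling consists of an encoder $f:\mathcal X_A^n\to\{1,\dots,J\}$ and a decoder $\varphi:\{1,\dots,J\}\to\mathcal Y_B^n$; its rate is $\frac1n\log_2J$. Put $d(x_B^n,y_B^n)=\frac1n\sum_{t=1}^nd(x_{Bt},y_{Bt})$. A number $R\ge0$ is achievable at distortion level $\Delta$ if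 for every $\epsilon>0$ and all sufficiently large $n$ there is an $n$-length code of rate less than $R+\epsilon$ with $\mathbb E[d(X_B^n,\varphi(f(X_A^n)))]\le\Delta+\epsilon$ in the Bayesian setting, respectively $\max_{\tau\in\Theta}\mathbb E[d(X_B^n,\varphi(f(X_A^n)))\,|\,\theta=\tau]\le\Delta+\epsilon$ in the nonBayesian setting. The universal sampling rate distortion function $R_A(\Delta)$ is the infimum of the achievable $R$. Let $\Theta_1$ be the partition of $\Theta$ into atoms of parameters $\tau$ with identical marginal $P_{X_A|\theta=\tau}$, let $\Lambda(\tau_1)$ be the set of parameters in the atom $\tau_1\in\Theta_1$, let $\theta_1$ be the atom containing $\theta$, and let $P_{X_A|\theta_1=\tau_1}$ be the common marginal of $X_A$ for $\tau\in\Lambda(\tau_1)$. Mutual information $I$ is in bits, and a minimum over an empty set is $+\infty$. (i) Bayesian setting. Let $d_{\tau_1}(x_A,y_B)=\mathbb E[d(X_B,y_B)\,|\,X_A=x_A,\theta_1=\tau_1]$ and let $$\rho_A^{\mathcal B}(\delta,\tau_1)=\min I(X_A\wedge Y_B\,|\,\theta_1=\tau_1),$$ the minimum being over all joint pmfs of $(\theta,X_{\mathcal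 M},Y_B)$ with the given pmf of $(\theta,X_{\mathcal M})$, such that $Y_B$ is conditionally independent of $(\theta,X_{\mathcal M})$ given $(\theta_1,X_A)$ and $\mathbb E[d_{\tau_1}(X_A,Y_B)\,|\,\theta_1=\tau_1]\le\delta$. Then for $\Delta_{\min}\le\Delta\le\Delta_{\max}$ $$R_A(\Delta)=\min_{\{\Delta_{\tau_1}\in\mathbb R,\ \tau_1\in\Theta_1\}:\ \mathbb E[\Delta_{\theta_1}]\le\Delta}\ \max_{\tau_1\in\Theta_1}\rho_A^{\mathcal B}(\Delta_{\tau_1},\tau_1),$$ where $$\Delta_{\min}=\mathbb E\Big[\mathbb E\big[\min_{y_B\in\mathcal Y_B}d_{\theta_1}(X_A,y_B)\,\big|\,\theta_1\big]\Big]=\mathbb E\big[\min_{y_B\in\mathcal Y_B}d_{\theta_1}(X_A,y_B)\big],\qquad \Delta_{\max}=\mathbb E\Big[\min_{y_B\in\mathcal Y_B}\mathbb E\big[d_{\theta_1}(X_A,y_B)\,\big|\,\theta_1\big]\Big].$$ (ii) NonBayesian setting. For a conditional pmf $W=P_{Y_B|X_A,\theta_1=\tau_1}$ and $\tau\in\Lambda(\tau_1)$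 let $\mathbb E[d(X_B,Y_B)|\theta=\tau]$ be computed under $P_{X_{\mathcal M}|\theta=\tau}\,W$, and let $$\rho_A^{n\mathcal B}(\delta,\tau_1)=\min\{I(X_A\wedge Y_B\,|\,\theta_1=\tau_1):\ W \text{ with } \mathbb E[d(X_B,Y_B)|\theta=\tau]\le\delta\text{ for all }\tau\in\Lambda(\tau_1)\}.$$ Then for $\Delta_{\min}\le\Delta\le\Delta_{\max}$ $$R_A(\Delta)=\max_{\tau_1\in\Theta_1}\rho_A^{n\mathcal B}(\Delta,\tau_1),$$ where $$\Delta_{\min}=\max_{\tau_1\in\Theta_1}\min_{W}\max_{\tau\in\Lambda(\tau_1)}\mathbb E[d(X_B,Y_B)|\theta=\tau],\qquad \Delta_{\max}=\max_{\tau_1\in\Theta_1}\min_{y_B\in\mathcal Y_B}\max_{\tau\in\Lambda(\tau_1)}\mathbb E[d(X_B,y_B)|\theta=\tau].$$ All the minima above exist, those in the definitions of $\rho_A^{\mathcal B}$ and $\rho_A^{n\mathcal B}$ whenever the constraint set is nonempty. -/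

import Mathlib

open Filter Finset

noncomputable section

namespace USRD

/-! ### Elementary probability on finite sets

A pmf on a finite set `Ω` is a function `p : Ω → ℝ` lying in `stdSimplex ℝ Ω`. -/

/-- Probability of the event `E` under `p`. -/
def prob {Ω : Type*} [Fintype Ω] (p : Ω → ℝ) (E : Set Ω) : ℝ :=
  ∑ ω, E.indicator p ω

/-- Expectation of `f` under `p`. -/
def expect {Ω : Type*} [Fintype Ω] (p : Ω → ℝ) (f : Ω → ℝ) : ℝ :=
  ∑ ω, p ω * f ω

/-- Conditional expectation of `f` given the event `E` (only used for events of positive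
probability). -/
def condExpect {Ω : Type*} [Fintype Ω] (p : Ω → ℝ) (E : Set Ω) (f : Ω → ℝ) : ℝ :=
  (∑ ω, E.indicator (fun ω => p ω * f ω) ω) / prob p E

/-- Conditional probability of `F` given `E`. -/
def condProb {Ω : Type*} [Fintype Ω] (p : Ω → ℝ) (F E : Set Ω) : ℝ :=
  prob p (F ∩ E) / prob p E

/-- The random variables `U`, `V`, `W` form a Markov chain `U -- V -- W` under `p`. -/
def IsMarkov {Ω α β γ : Type*} [Fintype Ω] (p : Ω → ℝ) (U : Ω → α) (V : Ω → β) (W : Ω → γ) :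
    Prop :=
  ∀ u v w, prob p {ω | U ω = u ∧ V ω = v ∧ W ω = w} * prob p {ω | V ω = v} =
    prob p {ω | U ω = u ∧ V ω = v} * prob p {ω | V ω = v ∧ W ω = w}

/-- Mutual information in bits of the joint pmf `r`, with `0 log 0 = 0`. -/
def mutualInfo {α β : Type*} [Fintype α] [Fintype β] (r : α → β → ℝ) : ℝ :=
  ∑ a, ∑ b, r a b * Real.logb 2 (r a b / ((∑ b', r a b') * (∑ a', r a' b)))

/-! ### The source -/

section Model

variable {m : ℕ} {X Y : Fin m → Type*} {Θ : Type*}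

/-- The alphabet of the components with indices in `A`. -/
abbrev Sub (X : Fin m → Type*) (A : Finset (Fin m)) : Type _ := ∀ i : A, X i

variable [∀ i, Fintype (X i)] [∀ i, Fintype (Y i)] [Fintype Θ]

/-- The marginal pmf of `X_A` when `X_M` has pmf `p`. -/
def marg (A : Finset (Fin m)) (p : (∀ i, X i) → ℝ) (a : Sub X A) : ℝ :=
  prob p {x | A.restrict x = a}

/-- Two parameters are equivalent when they yield the same marginal pmf of `X_A`. -/
def ambiguity (P : Θ → (∀ i, X i) → ℝ) (A : Finset (Fin m)) : Setoid Θ :=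
  Setoid.ker fun τ => marg A (P τ)

/-- The set `Θ₁` of ambiguity atoms. -/
def Atom (P : Θ → (∀ i, X i) → ℝ) (A : Finset (Fin m)) : Type _ :=
  Quotient (ambiguity P A)

/-- The atom to which a parameter belongs. -/
def atomOf (P : Θ → (∀ i, X i) → ℝ) (A : Finset (Fin m)) (τ : Θ) : Atom P A :=
  Quotient.mk (ambiguity P A) τ

instance (P : Θ → (∀ i, X i) → ℝ) (A : Finset (Fin m)) : Finite (Atom P A) :=
  inferInstanceAs (Finite (Quotient (ambiguity P A)))

instance (P : Θ → (∀ i, X i) → ℝ) (A : Finset (Fin m)) : Fintype (Atom P A) :=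
  Fintype.ofFinite _

/-- `Λ(τ₁)`: the parameters in the atom `τ₁`. -/
def Lam (P : Θ → (∀ i, X i) → ℝ) (A : Finset (Fin m)) (τ₁ : Atom P A) : Set Θ :=
  {τ | atomOf P A τ = τ₁}

/-- The common marginal pmf of `X_A` under the parameters in the atom `τ₁`. -/
def atomMarg (P : Θ → (∀ i, X i) → ℝ) (A : Finset (Fin m)) (τ₁ : Atom P A) : Sub X A → ℝ :=
  Quotient.lift (fun τ => marg A (P τ)) (fun _ _ h => h) τ₁

/-! ### Codes with fixed-set sampling and the operational rate distortion function -/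

/-- An `n`-length block code with fixed-set sampler `A` and recovery set `B`: the sampler output is
`X_A^n` (the sampling set is `A` at every time instant). -/
structure FSCode (X Y : Fin m → Type*) (A B : Finset (Fin m)) (n : ℕ) where
  /-- size of the range of the encoder -/
  J : ℕ
  /-- encoder -/
  enc : (Fin n → Sub X A) → Fin J
  /-- decoder -/
  dec : Fin J → (Fin n → Sub Y B)

/-- Rate of a code, in bits per time instant. -/
def FSCode.rate {A B : Finset (Fin m)} {n : ℕ} (c : FSCode X Y A B n) : ℝ :=
  1 / (n : ℝ) * Real.logb 2 c.J

/-- `E[d(X_B^n, φ(f(X_A^n))) | θ = τ]`, where `X_{M1}, …, X_{Mn}` are i.i.d. with pmf `p = P τ`. -/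
def FSCode.distortion {A B : Finset (Fin m)} {n : ℕ} (c : FSCode X Y A B n)
    (d : Sub X B → Sub Y B → ℝ) (p : (∀ i, X i) → ℝ) : ℝ :=
  expect (fun x : Fin n → ∀ i, X i => ∏ t, p (x t)) fun x =>
    1 / (n : ℝ) * ∑ t, d (B.restrict (x t)) (c.dec (c.enc fun s => A.restrict (x s)) t)

/-- `R` is an achievable rate at distortion level `Δ` under the expected distortion criterion. -/
def AchievableBayes (P : Θ → (∀ i, X i) → ℝ) (μ : Θ → ℝ) (A B : Finset (Fin m))
    (d : Sub X B → Sub Y B → ℝ) (Δ R : ℝ) : Prop :=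
  0 ≤ R ∧ ∀ ε > 0, ∀ᶠ n in atTop, ∃ c : FSCode X Y A B n,
    c.rate < R + ε ∧ expect μ (fun τ => c.distortion d (P τ)) ≤ Δ + ε

/-- `R` is an achievable rate at distortion level `Δ` under the peak distortion criterion. -/
def AchievablePeak (P : Θ → (∀ i, X i) → ℝ) (A B : Finset (Fin m))
    (d : Sub X B → Sub Y B → ℝ) (Δ R : ℝ) : Prop :=
  0 ≤ R ∧ ∀ ε > 0, ∀ᶠ n in atTop, ∃ c : FSCode X Y A B n,
    c.rate < R + ε ∧ ∀ τ, c.distortion d (P τ) ≤ Δ + ε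

/-- The Bayesian universal sampling rate distortion function: the infimum of achievable rates
(`⊤` if there are none). -/
def usrdfBayes (P : Θ → (∀ i, X i) → ℝ) (μ : Θ → ℝ) (A B : Finset (Fin m))
    (d : Sub X B → Sub Y B → ℝ) (Δ : ℝ) : EReal :=
  ⨅ R ∈ {R : ℝ | AchievableBayes P μ A B d Δ R}, (R : EReal)

/-- The nonBayesian universal sampling rate distortion function: the infimum of achievable rates
(`⊤` if there are none). -/
def usrdfPeak (P : Θ → (∀ i, X i) → ℝ) (A B : Finset (Fin m))
    (d : Sub X B → Sub Y B → ℝ) (Δ : ℝ) : EReal :=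
  ⨅ R ∈ {R : ℝ | AchievablePeak P A B d Δ R}, (R : EReal)

/-! ### Single-letter quantities in the Bayesian setting -/

/-- The joint pmf of `(θ, X_M)`. -/
def source (P : Θ → (∀ i, X i) → ℝ) (μ : Θ → ℝ) (ω : Θ × (∀ i, X i)) : ℝ :=
  μ ω.1 * P ω.1 ω.2

/-- The pmf of `θ₁` induced by the pmf `μ` of `θ`. -/
def atomPmf (P : Θ → (∀ i, X i) → ℝ) (μ : Θ → ℝ) (A : Finset (Fin m)) (τ₁ : Atom P A) : ℝ :=
  prob μ (Lam P A τ₁)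

/-- The modified distortion `d_{τ₁}(a, y) = E[d(X_B, y) | X_A = a, θ₁ = τ₁]`. -/
def dAtom (P : Θ → (∀ i, X i) → ℝ) (μ : Θ → ℝ) (A B : Finset (Fin m))
    (d : Sub X B → Sub Y B → ℝ) (τ₁ : Atom P A) (a : Sub X A) (y : Sub Y B) : ℝ :=
  condExpect (source P μ) {ω | A.restrict ω.2 = a ∧ atomOf P A ω.1 = τ₁}
    fun ω => d (B.restrict ω.2) y

/-- The constrained set of joint pmfs of `(θ, X_M, Y_B)`, with the given pmf of `(θ, X_M)`, such
that `θ, X_M -- θ₁, X_A -- Y_B` and `E[d_{τ₁}(X_A, Y_B) | θ₁ = τ₁] ≤ δ`. -/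
def kappaBayes (P : Θ → (∀ i, X i) → ℝ) (μ : Θ → ℝ) (A B : Finset (Fin m))
    (d : Sub X B → Sub Y B → ℝ) (δ : ℝ) (τ₁ : Atom P A) :
    Set (Θ × (∀ i, X i) × Sub Y B → ℝ) :=
  {Q | Q ∈ stdSimplex ℝ (Θ × (∀ i, X i) × Sub Y B) ∧
    (∀ τ x, ∑ y, Q (τ, x, y) = source P μ (τ, x)) ∧
    IsMarkov Q (fun ω => (ω.1, ω.2.1)) (fun ω => (atomOf P A ω.1, A.restrict ω.2.1))
      (fun ω => ω.2.2) ∧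
    condExpect Q {ω | atomOf P A ω.1 = τ₁}
      (fun ω => dAtom P μ A B d τ₁ (A.restrict ω.2.1) ω.2.2) ≤ δ}

/-- `I(X_A ∧ Y_B | θ₁ = τ₁)` when `(θ, X_M, Y_B)` has pmf `Q`. -/
def infoBayes (P : Θ → (∀ i, X i) → ℝ) (A B : Finset (Fin m)) (τ₁ : Atom P A)
    (Q : Θ × (∀ i, X i) × Sub Y B → ℝ) : ℝ :=
  mutualInfo fun (a : Sub X A) (y : Sub Y B) =>
    condProb Q {ω | A.restrict ω.2.1 = a ∧ ω.2.2 = y} {ω | atomOf P A ω.1 = τ₁}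

/-- `ρ_A^B(δ, τ₁)`, equal to `⊤` if the constraint set is empty. -/
def rhoBayes (P : Θ → (∀ i, X i) → ℝ) (μ : Θ → ℝ) (A B : Finset (Fin m))
    (d : Sub X B → Sub Y B → ℝ) (δ : ℝ) (τ₁ : Atom P A) : EReal :=
  ⨅ Q ∈ kappaBayes P μ A B d δ τ₁, (infoBayes P A B τ₁ Q : EReal)

/-- `Δ_min = E[E[min_y d_{θ₁}(X_A, y) | θ₁]]`. -/
def deltaMinBayes (P : Θ → (∀ i, X i) → ℝ) (μ : Θ → ℝ) (A B : Finset (Fin m))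
    (d : Sub X B → Sub Y B → ℝ) : ℝ :=
  expect (atomPmf P μ A) fun τ₁ =>
    condExpect (source P μ) {ω | atomOf P A ω.1 = τ₁}
      fun ω => ⨅ y : Sub Y B, dAtom P μ A B d τ₁ (A.restrict ω.2) y

/-- `Δ_max = E[min_y E[d_{θ₁}(X_A, y) | θ₁]]`. -/
def deltaMaxBayes (P : Θ → (∀ i, X i) → ℝ) (μ : Θ → ℝ) (A B : Finset (Fin m))
    (d : Sub X B → Sub Y B → ℝ) : ℝ :=
  expect (atomPmf P μ A) fun τ₁ =>
    ⨅ y : Sub Y B, condExpect (source P μ) {ω | atomOf P A ω.1 = τ₁}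
      fun ω => dAtom P μ A B d τ₁ (A.restrict ω.2) y

/-! ### Single-letter quantities in the nonBayesian setting -/

/-- The conditional pmfs `P_{Y_B | X_A, θ₁ = τ₁}`. -/
def channels (X Y : Fin m → Type*) [∀ i, Fintype (Y i)] (A B : Finset (Fin m)) :
    Set (Sub X A → Sub Y B → ℝ) :=
  {W | ∀ a, W a ∈ stdSimplex ℝ (Sub Y B)}

/-- `E[d(X_B, Y_B) | θ = τ]` when `P_{X_M Y_B | θ = τ} = p · W` with `p = P_{X_M | θ = τ}` and
`W = P_{Y_B | X_A, θ₁ = τ₁}`. -/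
def chanDistortion {A B : Finset (Fin m)} (d : Sub X B → Sub Y B → ℝ) (p : (∀ i, X i) → ℝ)
    (W : Sub X A → Sub Y B → ℝ) : ℝ :=
  expect (fun ω : (∀ i, X i) × Sub Y B => p ω.1 * W (A.restrict ω.1) ω.2)
    fun ω => d (B.restrict ω.1) ω.2

/-- The constrained set of `P_{Y_B | X_A, θ₁ = τ₁}` with `E[d(X_B, Y_B) | θ = τ] ≤ δ` for every
`τ ∈ Λ(τ₁)`. -/
def kappaPeak (P : Θ → (∀ i, X i) → ℝ) (A B : Finset (Fin m))
    (d : Sub X B → Sub Y B → ℝ) (δ : ℝ) (τ₁ : Atom P A) : Set (Sub X A → Sub Y B → ℝ) :=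
  {W | W ∈ channels X Y A B ∧ ∀ τ ∈ Lam P A τ₁, chanDistortion d (P τ) W ≤ δ}

/-- `I(X_A ∧ Y_B | θ₁ = τ₁)` when `P_{Y_B | X_A, θ₁ = τ₁} = W`. -/
def infoPeak (P : Θ → (∀ i, X i) → ℝ) (A B : Finset (Fin m)) (τ₁ : Atom P A)
    (W : Sub X A → Sub Y B → ℝ) : ℝ :=
  mutualInfo fun (a : Sub X A) (y : Sub Y B) => atomMarg P A τ₁ a * W a y

/-- `ρ_A^{nB}(δ, τ₁)`, equal to `⊤` if the constraint set is empty. -/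
def rhoPeak (P : Θ → (∀ i, X i) → ℝ) (A B : Finset (Fin m))
    (d : Sub X B → Sub Y B → ℝ) (δ : ℝ) (τ₁ : Atom P A) : EReal :=
  ⨅ W ∈ kappaPeak P A B d δ τ₁, (infoPeak P A B τ₁ W : EReal)

/-- `max_{τ ∈ Λ(τ₁)} E[d(X_B, Y_B) | θ = τ]` for `P_{Y_B | X_A, θ₁ = τ₁} = W`. -/
def worstDistortion (P : Θ → (∀ i, X i) → ℝ) (A B : Finset (Fin m))
    (d : Sub X B → Sub Y B → ℝ) (τ₁ : Atom P A) (W : Sub X A → Sub Y B → ℝ) : ℝ :=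
  ⨆ τ : Lam P A τ₁, chanDistortion d (P τ) W

/-- `Δ_min = max_{τ₁} min_W max_{τ ∈ Λ(τ₁)} E[d(X_B, Y_B) | θ = τ]`. -/
def deltaMinPeak (P : Θ → (∀ i, X i) → ℝ) (A B : Finset (Fin m))
    (d : Sub X B → Sub Y B → ℝ) : ℝ :=
  ⨆ τ₁ : Atom P A, ⨅ W : channels X Y A B, worstDistortion P A B d τ₁ W

/-- `Δ_max = max_{τ₁} min_y max_{τ ∈ Λ(τ₁)} E[d(X_B, y) | θ = τ]`. -/
def deltaMaxPeak (P : Θ → (∀ i, X i) → ℝ) (A B : Finset (Fin m))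
    (d : Sub X B → Sub Y B → ℝ) : ℝ :=
  ⨆ τ₁ : Atom P A, ⨅ y : Sub Y B, ⨆ τ : Lam P A τ₁,
    expect (P τ) fun x => d (B.restrict x) y

end Model

end USRD

end

namespace USRD

/-! ### Probabilities and products of pmfs on finite sets -/

section Prob

variable {Ω : Type*} [Fintype Ω] {p : Ω → ℝ}

/-! A code sees only `X_A^n`, whose law depends on `τ` only through its atom `s`: it is i.i.d. with
the full-support pmf `Q s = atomMarg P A s`. Replacing `d` by its conditional mean given `X_A` under
`τ` (`condDist`) turns the distortion of a code under `τ` into an expectation over `X_A^n` alone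
(`FSCode.distortion_eq`). The theorem then becomes a question about finitely many distinct
memoryless sources `Q s` and test channels `W s`.

Achievability (`eventually_exists_universal_code`): random covering yields, for each atom, a
codebook of about `2^(n I)` words, one of which is jointly typical with the source word with high
probability. The encoder searches the union of these codebooks. Joint typicality fixes the empirical
law of the source word, and the pmfs `Q s` are distinct, so any hit lies in the codebook of the true
atom. The union costs `log |Θ₁| / n` in rate, which vanishes, so the rate is the maximum of the
mutual informations. Joint typicality controls every letterwise cost at once, hence every `τ` in an
atom.

Converse (`exists_channel_of_code`): under each `Q s`, the time-averaged joint law of a source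
letter and its reproduction defines a channel that has exactly the distortion of the code and mutual
information at most its rate. Compactness of the set of channels removes the slack `ε`
(`exists_forall_le_of_forall_pos`).

For peak distortion the constraints separate over atoms, which gives the maximum of the single-atom
minima. For expected distortion only the average over atoms is constrained
(`expect_atomDistortion`), so the distortion budget may be split among the atoms; the optimal split
is read off from the limiting channels at the infimum rate (`isLeast_usrdfBayes`). -/

theorem prob_nonneg (hp : ∀ ω, 0 ≤ p ω) (E : Set Ω) : 0 ≤ prob p E :=
  Finset.sum_nonneg fun ω _ => Set.indicator_nonneg (fun ω _ => hp ω) ω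

theorem prob_mono (hp : ∀ ω, 0 ≤ p ω) {E F : Set Ω} (h : E ⊆ F) : prob p E ≤ prob p F :=
  Finset.sum_le_sum fun ω _ => Set.indicator_le_indicator_of_subset h hp ω

theorem prob_iUnion_le {ι : Type*} [Fintype ι] (hp : ∀ ω, 0 ≤ p ω) (E : ι → Set Ω) :
    prob p (⋃ i, E i) ≤ ∑ i, prob p (E i) := by
  simp only [prob]
  rw [Finset.sum_comm]
  refine Finset.sum_le_sum fun ω _ => ?_
  by_cases h : ω ∈ ⋃ i, E i
  · obtain ⟨i, hi⟩ := Set.mem_iUnion.1 h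
    rw [Set.indicator_of_mem h, ← Set.indicator_of_mem hi p]
    exact Finset.single_le_sum (f := fun i => (E i).indicator p ω)
      (fun i _ => Set.indicator_nonneg (fun ω _ => hp ω) ω) (Finset.mem_univ i)
  · rw [Set.indicator_of_notMem h]
    exact Finset.sum_nonneg fun i _ => Set.indicator_nonneg (fun ω _ => hp ω) ω

end Prob

section Power

variable {Z : Type*} [Fintype Z] {p : Z → ℝ} {n : ℕ}

theorem sum_prod_eq_one (h1 : ∑ z, p z = 1) : ∑ z : Fin n → Z, ∏ t, p (z t) = 1 := by
  rw [← Fintype.prod_sum (fun (_ : Fin n) z => p z)]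
  simp [h1]

theorem sum_prod_mul_apply (h1 : ∑ z, p z = 1) (i : Fin n) (h : Z → ℝ) :
    ∑ z : Fin n → Z, (∏ t, p (z t)) * h (z i) = ∑ z, p z * h z := by
  have e : ∀ z : Fin n → Z, (∏ t, p (z t)) * h (z i) =
      ∏ t, p (z t) * (if t = i then h (z t) else 1) := fun z => by
    rw [Finset.prod_mul_distrib, Finset.prod_ite_eq']
    simp
  simp only [e]
  rw [← Fintype.prod_sum (fun (t : Fin n) z => p z * (if t = i then h z else 1)),
    Finset.prod_eq_single i]
  · simp
  · intro t _ ht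
    simp [ht, h1]
  · simp

theorem sum_prod_mul_apply_mul_apply {i j : Fin n} (hij : i ≠ j) (h : Z → ℝ)
    (h0 : ∑ z, p z * h z = 0) :
    ∑ z : Fin n → Z, (∏ t, p (z t)) * (h (z i) * h (z j)) = 0 := by
  have e : ∀ z : Fin n → Z, (∏ t, p (z t)) * (h (z i) * h (z j)) =
      ∏ t, p (z t) * ((if t = i then h (z t) else 1) * (if t = j then h (z t) else 1)) := fun z => by
    rw [Finset.prod_mul_distrib, Finset.prod_mul_distrib, Finset.prod_ite_eq',
      Finset.prod_ite_eq']
    simp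
  simp only [e]
  rw [← Fintype.prod_sum
    (fun (t : Fin n) z => p z * ((if t = i then h z else 1) * (if t = j then h z else 1)))]
  refine Finset.prod_eq_zero (Finset.mem_univ i) ?_
  simpa [hij] using h0

/-- Variances add: after expanding the square, independence and centering kill the off-diagonal
terms. -/
theorem sum_prod_mul_sum_sq (h1 : ∑ z, p z = 1) (h : Z → ℝ) (h0 : ∑ z, p z * h z = 0) :
    ∑ z : Fin n → Z, (∏ t, p (z t)) * (∑ t, h (z t)) ^ 2 = n * ∑ z, p z * h z ^ 2 := by
  have e : ∀ z : Fin n → Z, (∏ t, p (z t)) * (∑ t, h (z t)) ^ 2 =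
      ∑ i, ∑ j, (∏ t, p (z t)) * (h (z i) * h (z j)) := fun z => by
    rw [sq, Finset.sum_mul_sum, Finset.mul_sum]
    simp only [Finset.mul_sum]
  simp only [e]
  rw [Finset.sum_comm]
  have : ∀ i : Fin n, ∑ z : Fin n → Z, ∑ j, (∏ t, p (z t)) * (h (z i) * h (z j)) =
      ∑ z, p z * h z ^ 2 := fun i => by
    rw [Finset.sum_comm, Finset.sum_eq_single i]
    · simp only [← sq]
      exact sum_prod_mul_apply h1 i fun z => h z ^ 2
    · intro j _ hj
      exact sum_prod_mul_apply_mul_apply hj.symm h h0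
    · simp
  simp [this]

/-- Chebyshev's inequality for the sample mean. -/
theorem prob_sampleMean_le (hp : ∀ z, 0 ≤ p z) (h1 : ∑ z, p z = 1) (h : Z → ℝ) {δ : ℝ}
    (hδ : 0 < δ) (hn : 0 < n) :
    prob (fun z : Fin n → Z => ∏ t, p (z t))
      {z | δ < |(1 / n : ℝ) * ∑ t, h (z t) - ∑ z, p z * h z|} ≤
      (∑ z, p z * (h z - ∑ z, p z * h z) ^ 2) / δ ^ 2 * (1 / n) := by
  set e := ∑ z, p z * h z with he
  have hn' : (0 : ℝ) < n := by exact_mod_cast hn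
  have h0 : ∑ z, p z * (h z - e) = 0 := by
    simp only [mul_sub, Finset.sum_sub_distrib, ← Finset.sum_mul, h1, ← he]
    simp
  have key := sum_prod_mul_sum_sq (n := n) h1 (fun z => h z - e) h0
  have le : prob (fun z : Fin n → Z => ∏ t, p (z t)) {z | δ < |(1 / n : ℝ) * ∑ t, h (z t) - e|} ≤
      ∑ z : Fin n → Z, (∏ t, p (z t)) * (∑ t, (h (z t) - e)) ^ 2 * (1 / (n * δ)) ^ 2 := by
    refine Finset.sum_le_sum fun z _ => ?_
    have hpz : 0 ≤ ∏ t, p (z t) := Finset.prod_nonneg fun t _ => hp _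
    by_cases hz : z ∈ {z : Fin n → Z | δ < |(1 / n : ℝ) * ∑ t, h (z t) - e|}
    · rw [Set.indicator_of_mem hz, mul_assoc, ← mul_pow]
      refine le_mul_of_one_le_right hpz ?_
      have : (∑ t, (h (z t) - e)) * (1 / (n * δ)) = ((1 / n : ℝ) * ∑ t, h (z t) - e) / δ := by
        rw [Finset.sum_sub_distrib]
        simp only [Finset.sum_const, Finset.card_univ, Fintype.card_fin, nsmul_eq_mul]
        field_simp
      rw [this, one_le_sq_iff_one_le_abs, abs_div, abs_of_pos hδ, one_le_div hδ]
      exact le_of_lt hz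
    · rw [Set.indicator_of_notMem hz]
      positivity
  refine le.trans (le_of_eq ?_)
  rw [← Finset.sum_mul, key]
  field_simp

end Power

/-! ### Joint types -/

section Types

variable {U V : Type*}

open Classical in
/-- The joint type of two words. -/
noncomputable def jointType {n : ℕ} (x : Fin n → U) (y : Fin n → V) (a : U) (b : V) : ℝ :=
  (1 / n : ℝ) * ∑ t, if x t = a ∧ y t = b then 1 else 0

/-- The two words have joint type close to `r`. -/
def Typical (r : U → V → ℝ) (δ : ℝ) {n : ℕ} (x : Fin n → U) (y : Fin n → V) : Prop :=
  ∀ a b, |jointType x y a b - r a b| ≤ δ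

theorem jointType_nonneg {n : ℕ} (x : Fin n → U) (y : Fin n → V) (a : U) (b : V) :
    0 ≤ jointType x y a b :=
  mul_nonneg (by positivity) (Finset.sum_nonneg fun t _ => by split_ifs <;> norm_num)

theorem jointType_pos {n : ℕ} (x : Fin n → U) (y : Fin n → V) (t : Fin n) :
    0 < jointType x y (x t) (y t) := by
  have hn : (0 : ℝ) < n := by exact_mod_cast Fin.pos t
  refine mul_pos (by positivity) (Finset.sum_pos' (fun t _ => by split_ifs <;> norm_num)
    ⟨t, mem_univ t, by simp⟩)

theorem Typical.mono {r : U → V → ℝ} {δ δ' : ℝ} (h : δ ≤ δ') {n : ℕ} {x : Fin n → U}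
    {y : Fin n → V} (hT : Typical r δ x y) : Typical r δ' x y :=
  fun a b => (hT a b).trans h

variable [Fintype U] [Fintype V]

theorem sum_jointType_mul {n : ℕ} (x : Fin n → U) (y : Fin n → V) (h : U → V → ℝ) :
    ∑ a, ∑ b, jointType x y a b * h a b = (1 / n : ℝ) * ∑ t, h (x t) (y t) := by
  classical
  simp only [jointType, mul_assoc, Finset.sum_mul, ite_mul, one_mul, zero_mul, ← Finset.mul_sum]
  congr 1
  calc _ = ∑ a, ∑ t, ∑ b, (if x t = a ∧ y t = b then h a b else 0) :=
        Finset.sum_congr rfl fun a _ => Finset.sum_comm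
    _ = _ := by
      rw [Finset.sum_comm]
      refine Finset.sum_congr rfl fun t _ => ?_
      simp [ite_and]

/-- An empirical average is linear in the joint type, so a single typicality condition controls
every letterwise cost. It is applied to the information density, to the marginal indicators and to
the distortions. -/
theorem Typical.abs_sub_le {r : U → V → ℝ} {δ : ℝ} {n : ℕ} {x : Fin n → U} {y : Fin n → V}
    (hT : Typical r δ x y) (h : U → V → ℝ) :
    |(1 / n : ℝ) * ∑ t, h (x t) (y t) - ∑ a, ∑ b, r a b * h a b| ≤ δ * ∑ a, ∑ b, |h a b| := by
  rw [← sum_jointType_mul]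
  simp only [← Finset.sum_sub_distrib, ← sub_mul, Finset.mul_sum]
  refine (Finset.abs_sum_le_sum_abs _ _).trans (Finset.sum_le_sum fun a _ => ?_)
  refine (Finset.abs_sum_le_sum_abs _ _).trans (Finset.sum_le_sum fun b _ => ?_)
  rw [abs_mul]
  exact mul_le_mul_of_nonneg_right (hT a b) (abs_nonneg _)

/-- A pair of words drawn i.i.d. from `r` is typical with probability tending to one. -/
theorem tendsto_prob_not_typical {r : U → V → ℝ} (hr : ∀ a b, 0 ≤ r a b)
    (h1 : ∑ a, ∑ b, r a b = 1) {δ : ℝ} (hδ : 0 < δ) :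
    Tendsto (fun n : ℕ => prob (fun z : Fin n → U × V => ∏ t, r (z t).1 (z t).2)
      {z | ¬ Typical r δ (fun t => (z t).1) (fun t => (z t).2)}) atTop (nhds 0) := by
  classical
  have h1' : ∑ z : U × V, r z.1 z.2 = 1 := by rw [Fintype.sum_prod_type]; exact h1
  set h : U × V → U × V → ℝ := fun c z => if z.1 = c.1 ∧ z.2 = c.2 then 1 else 0 with hh
  -- Chebyshev's bound for the frequency of each pair of letters; a union bound over the finitely
  -- many pairs keeps the decay `1 / n`.
  set v : U × V → ℝ := fun c =>
    (∑ z : U × V, r z.1 z.2 * (h c z - ∑ z : U × V, r z.1 z.2 * h c z) ^ 2) / δ ^ 2 with hv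
  have lim : Tendsto (fun n : ℕ => ∑ c, v c * (1 / (n : ℝ))) atTop (nhds 0) := by
    have := (tendsto_one_div_atTop_nhds_zero_nat (𝕜 := ℝ)).const_mul (∑ c, v c)
    simpa [Finset.sum_mul] using this
  refine tendsto_of_tendsto_of_tendsto_of_le_of_le' tendsto_const_nhds lim
    (Eventually.of_forall fun n => prob_nonneg (fun z => Finset.prod_nonneg fun t _ => hr _ _) _) ?_
  filter_upwards [eventually_gt_atTop 0] with n hn
  have hp : ∀ z : Fin n → U × V, 0 ≤ ∏ t, r (z t).1 (z t).2 :=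
    fun z => Finset.prod_nonneg fun t _ => hr _ _
  refine (prob_mono hp ?_).trans ((prob_iUnion_le hp fun c : U × V =>
    {z : Fin n → U × V | δ < |(1 / n : ℝ) * ∑ t, h c (z t) - ∑ z : U × V, r z.1 z.2 * h c z|}).trans
      (Finset.sum_le_sum fun c _ =>
        prob_sampleMean_le (p := fun z : U × V => r z.1 z.2) (fun z => hr _ _) h1' (h c) hδ hn))
  intro z hz
  simp only [Typical, Set.mem_ofPred_eq, not_forall, not_le] at hz
  obtain ⟨a, b, hab⟩ := hz
  refine Set.mem_iUnion.2 ⟨(a, b), ?_⟩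
  have e : ∑ z : U × V, r z.1 z.2 * h (a, b) z = r a b := by
    simp only [hh]
    rw [Finset.sum_eq_single (a, b)]
    · simp
    · rintro ⟨a', b'⟩ _ hne
      rw [if_neg, mul_zero]
      rintro ⟨rfl, rfl⟩
      exact hne rfl
    · simp
  simp only [Set.mem_ofPred_eq, e]
  simpa [jointType, hh] using hab

end Types

/-! ### One-shot covering -/

section Covering

variable {𝒳 𝒴 : Type*} [Fintype 𝒳] [Fintype 𝒴]

/-- The chain is `(1 - α)^M ≤ exp (-α M) ≤ exp (-w M / γ)`, followed by convexity of `exp` on the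
segment from `0` to `-M / γ`. In use, `α` and `w` are the masses of the good set of a fixed `x`
under `q` and under `W x`. -/
theorem one_sub_pow_le {α w E : ℝ} {M : ℕ} (hα1 : α ≤ 1) (hw0 : 0 ≤ w) (hw1 : w ≤ 1)
    {γ : ℝ} (hγ : 0 < γ) (h : w ≤ γ * α) (hE : E = Real.exp (-(M / γ))) :
    (1 - α) ^ M ≤ 1 - w + E := by
  have c : Real.exp ((1 - w) • (0 : ℝ) + w • (-(M / γ))) ≤
      (1 - w) • Real.exp 0 + w • Real.exp (-(M / γ)) :=
    convexOn_exp.2 (Set.mem_univ _) (Set.mem_univ _) (by linarith) hw0 (by ring)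
  simp only [smul_eq_mul, mul_zero, zero_add, Real.exp_zero, mul_one] at c
  have h2 : (1 - α) ^ M ≤ Real.exp (-(α * M)) := by
    calc (1 - α) ^ M ≤ Real.exp (-α) ^ M :=
          pow_le_pow_left₀ (by linarith) (Real.one_sub_le_exp_neg α) M
      _ = Real.exp (-(α * M)) := by rw [← Real.exp_nat_mul]; congr 1; ring
  have h3 : Real.exp (-(α * M)) ≤ Real.exp (w * -(M / γ)) := by
    refine Real.exp_le_exp.2 ?_
    have : w / γ ≤ α := by rw [div_le_iff₀ hγ]; linarith
    have := mul_le_mul_of_nonneg_right this (Nat.cast_nonneg (α := ℝ) M)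
    have e : w * -(M / γ) = -(w / γ * M) := by ring
    rw [e]; linarith
  have h4 : w * Real.exp (-(M / γ)) ≤ E := by
    rw [hE]; exact mul_le_of_le_one_left (Real.exp_pos _).le hw1
  linarith

/-- One-shot covering lemma: if `W x y ≤ γ q y` on the good set, some codebook of `M` words
covers all but a small part of the space. -/
theorem exists_codebook (p : 𝒳 → ℝ) (hp : ∀ x, 0 ≤ p x) (hp1 : ∑ x, p x = 1)
    (q : 𝒴 → ℝ) (hq : ∀ y, 0 ≤ q y) (hq1 : ∑ y, q y = 1)
    (W : 𝒳 → 𝒴 → ℝ) (hW : ∀ x y, 0 ≤ W x y) (hW1 : ∀ x, ∑ y, W x y = 1)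
    (G : 𝒳 → 𝒴 → Prop) {γ : ℝ} (hγ : 0 < γ) (hG : ∀ x y, G x y → W x y ≤ γ * q y) (M : ℕ) :
    ∃ C : Fin M → 𝒴, prob p {x | ∀ j, ¬ G x (C j)} ≤
      prob (fun z : 𝒳 × 𝒴 => p z.1 * W z.1 z.2) {z | ¬ G z.1 z.2} + Real.exp (-(M / γ)) := by
  classical
  set E := Real.exp (-(M / γ)) with hE
  set η := prob (fun z : 𝒳 × 𝒴 => p z.1 * W z.1 z.2) {z | ¬ G z.1 z.2} + E with hη
  -- Random coding: the codewords are drawn independently from `q`, so a fixed `x` stays uncovered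
  -- with probability `(1 - q (G x))^M`.
  have avg : ∑ C : Fin M → 𝒴, (∏ j, q (C j)) * prob p {x | ∀ j, ¬ G x (C j)} ≤
      ∑ C : Fin M → 𝒴, (∏ j, q (C j)) * η := by
    rw [← Finset.sum_mul, sum_prod_eq_one hq1, one_mul]
    have e : ∀ C : Fin M → 𝒴, (∏ j, q (C j)) * prob p {x | ∀ j, ¬ G x (C j)} =
        ∑ x, p x * ∏ j, (if G x (C j) then 0 else q (C j)) := fun C => by
      simp only [prob, Finset.mul_sum]
      refine Finset.sum_congr rfl fun x _ => ?_
      by_cases hx : ∀ j, ¬ G x (C j)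
      · rw [Set.indicator_of_mem (by exact hx), mul_comm]
        simp [hx]
      · rw [Set.indicator_of_notMem (by exact hx)]
        push Not at hx
        obtain ⟨j, hj⟩ := hx
        rw [mul_zero, eq_comm, mul_eq_zero]
        exact Or.inr (Finset.prod_eq_zero (Finset.mem_univ j) (by simp [hj]))
    simp only [e]
    rw [Finset.sum_comm]
    have e2 : ∀ x, ∑ C : Fin M → 𝒴, p x * ∏ j, (if G x (C j) then 0 else q (C j)) =
        p x * (1 - ∑ y, if G x y then q y else 0) ^ M := fun x => by
      rw [← Finset.mul_sum,
        ← Fintype.prod_sum (fun (_ : Fin M) y => if G x y then 0 else q y)]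
      have : ∑ y, (if G x y then 0 else q y) = 1 - ∑ y, if G x y then q y else 0 := by
        rw [eq_sub_iff_add_eq, ← Finset.sum_add_distrib, ← hq1]
        refine Finset.sum_congr rfl fun y _ => ?_
        split_ifs <;> simp
      simp [this]
    simp only [e2]
    have b : ∀ x, p x * (1 - ∑ y, if G x y then q y else 0) ^ M ≤
        p x * (∑ y, if G x y then 0 else W x y) + p x * E := fun x => by
      rw [← mul_add]
      refine mul_le_mul_of_nonneg_left ?_ (hp x)
      have hs : ∑ y, (if G x y then 0 else W x y) = 1 - ∑ y, if G x y then W x y else 0 := by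
        rw [eq_sub_iff_add_eq, ← Finset.sum_add_distrib, ← hW1 x]
        refine Finset.sum_congr rfl fun y _ => ?_
        split_ifs <;> simp
      rw [hs]
      refine one_sub_pow_le ?_ ?_ ?_ hγ ?_ hE
      · rw [← hq1]
        refine Finset.sum_le_sum fun y _ => ?_
        split_ifs
        · exact le_rfl
        · exact hq y
      · exact Finset.sum_nonneg fun y _ => by split_ifs; exacts [hW x y, le_rfl]
      · rw [← hW1 x]
        refine Finset.sum_le_sum fun y _ => ?_
        split_ifs
        · exact le_rfl
        · exact hW x y
      · rw [Finset.mul_sum]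
        refine Finset.sum_le_sum fun y _ => ?_
        split_ifs with hg
        · exact hG x y hg
        · simp
    refine (Finset.sum_le_sum fun x _ => b x).trans (le_of_eq ?_)
    rw [Finset.sum_add_distrib, ← Finset.sum_mul, hp1, one_mul, hη]
    congr 1
    rw [prob, Fintype.sum_prod_type]
    refine Finset.sum_congr rfl fun x _ => ?_
    rw [Finset.mul_sum]
    refine Finset.sum_congr rfl fun y _ => ?_
    by_cases hg : G x y <;> simp [Set.indicator, hg]
  by_contra hcon
  push Not at hcon
  have hlt : ∑ C : Fin M → 𝒴, (∏ j, q (C j)) * η <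
      ∑ C : Fin M → 𝒴, (∏ j, q (C j)) * prob p {x | ∀ j, ¬ G x (C j)} := by
    -- A codebook of positive weight is needed to make the comparison of averages strict.
    have hne : ∃ C : Fin M → 𝒴, ∏ j, q (C j) ≠ 0 := by
      by_contra hall
      push Not at hall
      have h0 := sum_prod_eq_one (n := M) hq1
      simp [hall] at h0
    obtain ⟨C₀, hC₀⟩ := hne
    have pos : 0 < ∏ j, q (C₀ j) :=
      lt_of_le_of_ne (Finset.prod_nonneg fun j _ => hq _) hC₀.symm
    exact Finset.sum_lt_sum
      (fun C _ => mul_le_mul_of_nonneg_left (hcon C).le (Finset.prod_nonneg fun j _ => hq _))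
      ⟨C₀, Finset.mem_univ _, mul_lt_mul_of_pos_left (hcon C₀) pos⟩
  exact absurd avg (not_le.2 hlt)

end Covering

/-! ### Universal coding for a finite family of memoryless sources -/

section Achievability

/-- The conditional pmfs on `V` given an element of `U`. -/
def Channel (U V : Type*) [Fintype V] : Set (U → V → ℝ) :=
  {W | ∀ a, W a ∈ stdSimplex ℝ V}

variable {U V : Type*} [Fintype V]

theorem sum_joint_right {Q : U → ℝ} {W : U → V → ℝ} (hW : W ∈ Channel U V) (a : U) :
    ∑ b, Q a * W a b = Q a := by
  rw [← Finset.mul_sum, (hW a).2, mul_one]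

/-- Finitely many distinct pmfs have positive mutual distances. The factor `2` is for the triangle
inequality: two pmfs within `δ * k` of one empirical law must coincide. -/
theorem exists_separating_radius {S : Type*} [Finite S] {Q : S → U → ℝ}
    (hinj : Function.Injective Q) {ε : ℝ} (hε : 0 < ε) (k : ℝ) :
    ∃ δ > 0, δ ≤ ε ∧ ∀ s s', (∀ a, |Q s a - Q s' a| ≤ 2 * (δ * k)) → s = s' := by
  have h : ∀ᶠ δ in nhdsWithin (0 : ℝ) (Set.Ioi 0), ∀ s s',
      (∀ a, |Q s a - Q s' a| ≤ 2 * (δ * k)) → s = s' := by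
    rw [eventually_all]
    intro s
    rw [eventually_all]
    intro s'
    by_cases hs : s = s'
    · exact Eventually.of_forall fun _ _ => hs
    · obtain ⟨a, ha⟩ : ∃ a, Q s a ≠ Q s' a := Function.ne_iff.1 (hinj.ne hs)
      have hpos : 0 < |Q s a - Q s' a| := abs_pos.2 (sub_ne_zero.2 ha)
      have lim : Tendsto (fun δ : ℝ => 2 * (δ * k)) (nhdsWithin 0 (Set.Ioi 0)) (nhds 0) := by
        have : Tendsto (fun δ : ℝ => 2 * (δ * k)) (nhds 0) (nhds (2 * (0 * k))) :=
          (Continuous.tendsto (by fun_prop) 0)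
        simp only [zero_mul, mul_zero] at this
        exact this.mono_left nhdsWithin_le_nhds
      filter_upwards [lim.eventually_lt_const hpos] with δ hδ hall
      exact absurd (hall a) (not_le.2 hδ)
  have h2 : ∀ᶠ δ in nhdsWithin (0 : ℝ) (Set.Ioi 0), δ ≤ ε :=
    (eventually_le_nhds hε).filter_mono nhdsWithin_le_nhds
  obtain ⟨δ, ⟨h, h2⟩, h0⟩ := ((h.and h2).and self_mem_nhdsWithin).exists
  exact ⟨δ, h0, h2, h⟩

variable [Fintype U]

/-- The density whose mean is the mutual information. -/
noncomputable def infoDensity (r : U → V → ℝ) (a : U) (b : V) : ℝ :=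
  Real.logb 2 (r a b / ((∑ b', r a b') * (∑ a', r a' b)))

theorem sum_joint {Q : U → ℝ} {W : U → V → ℝ} (h1 : ∑ a, Q a = 1) (hW : W ∈ Channel U V) :
    ∑ a, ∑ b, Q a * W a b = 1 := by
  simp only [sum_joint_right hW, h1]

/-- Equality holds where `W a b > 0`. The inequality is only needed when `W a b = 0`, where `logb`
takes its default value. -/
theorem le_mul_rpow_infoDensity {Q : U → ℝ} {W : U → V → ℝ} (hQ : ∀ a, 0 < Q a)
    (hW : W ∈ Channel U V) (a : U) (b : V) :
    W a b ≤ (∑ a', Q a' * W a' b) * (2 : ℝ) ^ infoDensity (fun a b => Q a * W a b) a b := by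
  have hq : Q a * W a b ≤ ∑ a', Q a' * W a' b :=
    Finset.single_le_sum (f := fun a' => Q a' * W a' b)
      (fun a' _ => mul_nonneg (hQ a').le ((hW a').1 b)) (Finset.mem_univ a)
  rcases ((hW a).1 b).eq_or_lt with h | h
  · rw [← h] at hq ⊢
    have : 0 ≤ ∑ a', Q a' * W a' b := by simpa using hq
    positivity
  · have hQa := hQ a
    have hr : 0 < Q a * W a b := by positivity
    have hq0 := hr.trans_le hq
    rw [infoDensity, sum_joint_right hW, Real.rpow_logb (by norm_num) (by norm_num) (by positivity)]
    apply le_of_eq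
    field_simp

theorem prob_prod_not_typical (Q : U → ℝ) (W : U → V → ℝ) (δ : ℝ) (n : ℕ) :
    prob (fun z : (Fin n → U) × (Fin n → V) => (∏ t, Q (z.1 t)) * ∏ t, W (z.1 t) (z.2 t))
      {z | ¬ Typical (fun a b => Q a * W a b) δ z.1 z.2} =
    prob (fun z : Fin n → U × V => ∏ t, Q (z t).1 * W (z t).1 (z t).2)
      {z | ¬ Typical (fun a b => Q a * W a b) δ (fun t => (z t).1) (fun t => (z t).2)} := by
  symm
  refine Fintype.sum_equiv (Equiv.arrowProdEquivProdArrow (Fin n) (fun _ => U) (fun _ => V)) _ _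
    fun z => ?_
  simp only [Set.indicator, ← Finset.prod_mul_distrib]
  rfl

/-- One-shot covering with typicality as the good relation and `γ = 2 ^ (n (I + R) / 2)`. The
exponent halfway between `I` and `R` bounds the information density on typical pairs and still
leaves `M / γ` growing exponentially. -/
theorem eventually_exists_codebook {Q : U → ℝ} {W : U → V → ℝ} (hQ : ∀ a, 0 < Q a)
    (h1 : ∑ a, Q a = 1) (hW : W ∈ Channel U V) {R : ℝ}
    (hR : mutualInfo (fun a b => Q a * W a b) < R) {δ η : ℝ} (hδ : 0 < δ) (hη : 0 < η) :
    ∀ᶠ n : ℕ in atTop, ∀ M : ℕ, (2 : ℝ) ^ (n * R) ≤ M → ∃ C : Fin M → Fin n → V,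
      prob (fun x : Fin n → U => ∏ t, Q (x t))
        {x | ∀ j, ¬ Typical (fun a b => Q a * W a b) δ x (C j)} ≤ η := by
  set r : U → V → ℝ := fun a b => Q a * W a b with hr
  set I := mutualInfo r with hI
  set c := ∑ a, ∑ b, |infoDensity r a b| with hc
  have hc0 : 0 ≤ c := Finset.sum_nonneg fun a _ => Finset.sum_nonneg fun b _ => abs_nonneg _
  have hr0 : ∀ a b, 0 ≤ r a b := fun a b => mul_nonneg (hQ a).le ((hW a).1 b)
  -- The radius is shrunk so that the empirical information density of a typical pair exceeds `I` by
  -- at most `(R - I) / 2`. The `+ 1` guards against `c = 0`.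
  obtain ⟨δ', hδ', hδδ, hδc⟩ : ∃ δ' > 0, δ' ≤ δ ∧ δ' * c ≤ (R - I) / 2 := by
    refine ⟨min δ ((R - I) / 2 / (c + 1)), lt_min hδ (div_pos (by linarith) (by linarith)),
      min_le_left _ _, ?_⟩
    calc min δ ((R - I) / 2 / (c + 1)) * c ≤ (R - I) / 2 / (c + 1) * (c + 1) :=
          mul_le_mul (min_le_right _ _) (by linarith) hc0
            (div_nonneg (by linarith) (by linarith))
      _ = _ := by field_simp
  have lim1 := tendsto_prob_not_typical hr0 (sum_joint h1 hW) hδ'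
  have hb : 1 < (2 : ℝ) ^ ((R - I) / 2) := Real.one_lt_rpow (by norm_num) (by linarith)
  have lim2 : Tendsto (fun n : ℕ => Real.exp (-((2 : ℝ) ^ ((R - I) / 2)) ^ n)) atTop (nhds 0) :=
    Real.tendsto_exp_neg_atTop_nhds_zero.comp (tendsto_pow_atTop_atTop_of_one_lt hb)
  filter_upwards [lim1.eventually_lt_const (half_pos hη), lim2.eventually_lt_const (half_pos hη),
    eventually_gt_atTop 0] with n hn1 hn2 hn0 M hM
  have hn : (0 : ℝ) < n := by exact_mod_cast hn0
  set q : V → ℝ := fun b => ∑ a, r a b with hqd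
  have hq0 : ∀ b, 0 ≤ q b := fun b => Finset.sum_nonneg fun a _ => hr0 a b
  have hq1 : ∑ b, q b = 1 := by
    rw [hqd, Finset.sum_comm]; exact sum_joint h1 hW
  have hγ : (0 : ℝ) < 2 ^ (n * ((I + R) / 2)) := by positivity
  obtain ⟨C, hC⟩ := exists_codebook (fun x : Fin n → U => ∏ t, Q (x t))
    (fun x => Finset.prod_nonneg fun t _ => (hQ _).le) (sum_prod_eq_one h1)
    (fun y : Fin n → V => ∏ t, q (y t)) (fun y => Finset.prod_nonneg fun t _ => hq0 _)
    (sum_prod_eq_one hq1) (fun x y => ∏ t, W (x t) (y t))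
    (fun x y => Finset.prod_nonneg fun t _ => (hW _).1 _)
    (fun x => by
      rw [← Fintype.prod_sum (fun (t : Fin n) b => W (x t) b)]
      exact Finset.prod_eq_one fun t _ => (hW _).2)
    (fun x y => Typical r δ' x y) hγ
    (fun x y hxy => by
      have h2 : ∑ t, infoDensity r (x t) (y t) ≤ n * ((I + R) / 2) := by
        have h3 := (le_abs_self _).trans (hxy.abs_sub_le (infoDensity r))
        have h4 : ∑ a, ∑ b, r a b * infoDensity r a b = I := rfl
        rw [h4] at h3
        have h5 : (1 / n : ℝ) * ∑ t, infoDensity r (x t) (y t) ≤ (I + R) / 2 := by linarith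
        rw [one_div, inv_mul_le_iff₀ hn] at h5
        exact h5
      calc ∏ t, W (x t) (y t) ≤ ∏ t, q (y t) * (2 : ℝ) ^ infoDensity r (x t) (y t) :=
            Finset.prod_le_prod (fun t _ => (hW _).1 _)
              fun t _ => le_mul_rpow_infoDensity hQ hW _ _
        _ = (2 : ℝ) ^ (∑ t, infoDensity r (x t) (y t)) * ∏ t, q (y t) := by
            rw [Finset.prod_mul_distrib, mul_comm, Real.rpow_sum_of_pos (by norm_num)]
        _ ≤ _ := mul_le_mul_of_nonneg_right
            (Real.rpow_le_rpow_of_exponent_le (by norm_num) h2)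
            (Finset.prod_nonneg fun t _ => hq0 _)) M
  refine ⟨C, (prob_mono (fun x => Finset.prod_nonneg fun t _ => (hQ _).le) ?_).trans
    (hC.trans ?_)⟩
  · intro x hx j hj
    exact hx j (hj.mono hδδ)
  · rw [prob_prod_not_typical Q W δ' n]
    have : Real.exp (-(M / (2 : ℝ) ^ (n * ((I + R) / 2)))) ≤
        Real.exp (-((2 : ℝ) ^ ((R - I) / 2)) ^ n) := by
      rw [Real.exp_le_exp, neg_le_neg_iff, le_div_iff₀ hγ, ← Real.rpow_natCast, ← Real.rpow_mul
        (by norm_num), ← Real.rpow_add (by norm_num)]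
      refine le_of_eq_of_le ?_ hM
      congr 1; ring
    linarith

/-- Entries of a type and of a pmf both lie in `[0, 1]`. This supplies the crude bound used on
atypical words. -/
theorem typical_one {r : U → V → ℝ} (hr : ∀ a b, 0 ≤ r a b) (h1 : ∑ a, ∑ b, r a b = 1) {n : ℕ}
    (x : Fin n → U) (y : Fin n → V) : Typical r 1 x y := by
  classical
  intro a b
  have hr1 : r a b ≤ 1 := by
    rw [← h1]
    exact (Finset.single_le_sum (f := fun b => r a b) (fun b _ => hr a b) (Finset.mem_univ b)).trans
      (Finset.single_le_sum (f := fun a => ∑ b, r a b)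
        (fun a _ => Finset.sum_nonneg fun b _ => hr a b) (Finset.mem_univ a))
  have h0 : 0 ≤ jointType x y a b :=
    mul_nonneg (by positivity) (Finset.sum_nonneg fun t _ => by split_ifs <;> norm_num)
  have h2 : jointType x y a b ≤ 1 := by
    have : (∑ t, if x t = a ∧ y t = b then (1 : ℝ) else 0) ≤ n := by
      refine (Finset.sum_le_sum (g := fun _ => (1 : ℝ)) fun t _ => ?_).trans (by simp)
      split_ifs <;> norm_num
    rw [jointType, one_div]
    exact inv_mul_le_one_of_le₀ (by convert this) (by positivity)
  have := hr a b
  exact abs_le.2 ⟨by linarith, by linarith⟩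

theorem Typical.abs_marginal_sub_le [DecidableEq U] {Q : U → ℝ} {W : U → V → ℝ}
    (hW : W ∈ Channel U V) {δ : ℝ} {n : ℕ} {x : Fin n → U} {y : Fin n → V}
    (hT : Typical (fun a b => Q a * W a b) δ x y) (a : U) :
    |(1 / n : ℝ) * (∑ t, if x t = a then 1 else 0) - Q a| ≤ δ * Fintype.card V := by
  have := hT.abs_sub_le fun a' _ => if a' = a then 1 else 0
  have e1 : ∑ a', ∑ b, Q a' * W a' b * (if a' = a then (1 : ℝ) else 0) = Q a := by
    simp [sum_joint_right hW]
  have e2 : ∑ a', ∑ _b : V, |if a' = a then (1 : ℝ) else 0| = Fintype.card V := by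
    rw [Finset.sum_eq_single a]
    · simp
    · intro a' _ h
      simp [h]
    · simp
  rwa [e1, e2] at this

/-- The factor `k`, the number of codebooks, and the factor `2` lost by the ceiling contribute `logb
2 (k * 2) / n`, which tends to zero. -/
theorem eventually_rate_lt {k R ε : ℝ} (hk : 0 < k) (hR : 0 ≤ R) (hε : 0 < ε) :
    ∀ᶠ n : ℕ in atTop, 1 / (n : ℝ) * Real.logb 2 (k * ⌈(2 : ℝ) ^ (n * (R + ε / 2))⌉₊) < R + ε := by
  have lim : Tendsto (fun n : ℕ => 1 / (n : ℝ) * Real.logb 2 (k * 2)) atTop (nhds 0) := by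
    simpa using (tendsto_one_div_atTop_nhds_zero_nat (𝕜 := ℝ)).mul_const (Real.logb 2 (k * 2))
  filter_upwards [lim.eventually_lt_const (half_pos hε), eventually_gt_atTop 0] with n hn hn0
  have hn' : (0 : ℝ) < n := by exact_mod_cast hn0
  have hx : 1 ≤ (2 : ℝ) ^ (n * (R + ε / 2)) :=
    Real.one_le_rpow (by norm_num) (by positivity)
  have hM : (⌈(2 : ℝ) ^ (n * (R + ε / 2))⌉₊ : ℝ) ≤ 2 * (2 : ℝ) ^ (n * (R + ε / 2)) := by
    have := (Nat.ceil_lt_add_one (zero_le_one.trans hx)).le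
    linarith
  have hM0 : (0 : ℝ) < ⌈(2 : ℝ) ^ (n * (R + ε / 2))⌉₊ := by
    exact_mod_cast Nat.ceil_pos.2 (by positivity)
  have hle : Real.logb 2 (k * ⌈(2 : ℝ) ^ (n * (R + ε / 2))⌉₊) ≤
      Real.logb 2 (k * 2) + n * (R + ε / 2) := by
    have e : Real.logb 2 (k * 2) + n * (R + ε / 2) =
        Real.logb 2 (k * 2 * (2 : ℝ) ^ (n * (R + ε / 2))) := by
      rw [Real.logb_mul (x := k * 2) (by positivity) (by positivity), Real.logb_rpow (by norm_num) (by norm_num)]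
    rw [e]
    refine Real.logb_le_logb_of_le (by norm_num) (by positivity) ?_
    rw [mul_assoc]
    exact mul_le_mul_of_nonneg_left hM hk.le
  calc _ ≤ 1 / (n : ℝ) * (Real.logb 2 (k * 2) + n * (R + ε / 2)) :=
        mul_le_mul_of_nonneg_left hle (by positivity)
    _ = 1 / (n : ℝ) * Real.logb 2 (k * 2) + (R + ε / 2) := by field_simp
    _ < _ := by linarith

/-- Words whose pair is typical contribute `δ` and the others their probability, each times the size
of `h`. -/
theorem abs_expect_sub_le {r : U → V → ℝ} (hr : ∀ a b, 0 ≤ r a b) (h1 : ∑ a, ∑ b, r a b = 1)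
    {Q : U → ℝ} (hQ : ∀ a, 0 ≤ Q a) (hQ1 : ∑ a, Q a = 1) {δ : ℝ} (hδ : 0 ≤ δ) {n : ℕ}
    (φ : (Fin n → U) → Fin n → V) (h : U → V → ℝ) :
    |∑ x : Fin n → U, (∏ t, Q (x t)) * (1 / (n : ℝ) * ∑ t, h (x t) (φ x t)) -
      ∑ a, ∑ b, r a b * h a b| ≤
    (δ + prob (fun x : Fin n → U => ∏ t, Q (x t)) {x | ¬ Typical r δ x (φ x)}) *
      ∑ a, ∑ b, |h a b| := by
  set c := ∑ a, ∑ b, |h a b| with hc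
  have hc0 : 0 ≤ c := Finset.sum_nonneg fun a _ => Finset.sum_nonneg fun b _ => abs_nonneg _
  set e := ∑ a, ∑ b, r a b * h a b with he
  have e1 : ∑ x : Fin n → U, (∏ t, Q (x t)) * (1 / (n : ℝ) * ∑ t, h (x t) (φ x t)) - e =
      ∑ x : Fin n → U, (∏ t, Q (x t)) * (1 / (n : ℝ) * ∑ t, h (x t) (φ x t) - e) := by
    simp only [mul_sub, Finset.sum_sub_distrib]
    rw [← Finset.sum_mul, sum_prod_eq_one hQ1, one_mul]
  have e2 : (δ + prob (fun x : Fin n → U => ∏ t, Q (x t)) {x | ¬ Typical r δ x (φ x)}) * c =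
      ∑ x : Fin n → U, ((∏ t, Q (x t)) * (δ * c) +
        {x | ¬ Typical r δ x (φ x)}.indicator (fun x : Fin n → U => ∏ t, Q (x t)) x * c) := by
    rw [Finset.sum_add_distrib, ← Finset.sum_mul, ← Finset.sum_mul, sum_prod_eq_one hQ1, prob]
    ring
  rw [e1, e2]
  refine (Finset.abs_sum_le_sum_abs _ _).trans (Finset.sum_le_sum fun x _ => ?_)
  have hpx : 0 ≤ ∏ t, Q (x t) := Finset.prod_nonneg fun t _ => hQ _
  rw [abs_mul, abs_of_nonneg hpx]
  by_cases hT : Typical r δ x (φ x)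
  · rw [Set.indicator_of_notMem (by simpa using hT), zero_mul, add_zero]
    exact mul_le_mul_of_nonneg_left (hT.abs_sub_le h) hpx
  · rw [Set.indicator_of_mem (by exact hT)]
    have := mul_le_mul_of_nonneg_left ((typical_one hr h1 x (φ x)).abs_sub_le h) hpx
    rw [one_mul] at this
    have h3 : 0 ≤ (∏ t, Q (x t)) * (δ * c) := by positivity
    linarith

/-- Universal source coding: one code simulates the channel `W s` when the source is `Q s`, at a
rate close to the largest mutual information. -/
theorem eventually_exists_universal_code {S : Type*} [Fintype S] [Nonempty S] {Q : S → U → ℝ}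
    (hQ : ∀ s a, 0 < Q s a) (h1 : ∀ s, ∑ a, Q s a = 1) (hinj : Function.Injective Q)
    {W : S → U → V → ℝ} (hW : ∀ s, W s ∈ Channel U V) {R : ℝ} (hR0 : 0 ≤ R)
    (hR : ∀ s, mutualInfo (fun a b => Q s a * W s a b) ≤ R) {ε : ℝ} (hε : 0 < ε) :
    ∀ᶠ n : ℕ in atTop, ∃ (J : ℕ) (enc : (Fin n → U) → Fin J) (dec : Fin J → Fin n → V),
      1 / (n : ℝ) * Real.logb 2 J < R + ε ∧ ∀ (s : S) (h : U → V → ℝ),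
        |∑ x : Fin n → U, (∏ t, Q s (x t)) * (1 / (n : ℝ) * ∑ t, h (x t) (dec (enc x) t)) -
          ∑ a, ∑ b, Q s a * W s a b * h a b| ≤ ε * ∑ a, ∑ b, |h a b| := by
  classical
  obtain ⟨δ, hδ, hδε, hsep⟩ :=
    exists_separating_radius hinj (half_pos hε) (Fintype.card V)
  have cov : ∀ᶠ n : ℕ in atTop, ∀ s, ∀ M : ℕ, (2 : ℝ) ^ (n * (R + ε / 2)) ≤ M →
      ∃ C : Fin M → Fin n → V, prob (fun x : Fin n → U => ∏ t, Q s (x t))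
        {x | ∀ j, ¬ Typical (fun a b => Q s a * W s a b) δ x (C j)} ≤ ε / 2 := by
    rw [eventually_all]
    exact fun s => eventually_exists_codebook (hQ s) (h1 s) (hW s)
      (lt_of_le_of_lt (hR s) (by linarith)) hδ (half_pos hε)
  have hcard : (0 : ℝ) < Fintype.card S := by exact_mod_cast Fintype.card_pos
  filter_upwards [cov, eventually_rate_lt hcard hR0 hε] with n hcov hrate
  set M := ⌈(2 : ℝ) ^ (n * (R + ε / 2))⌉₊ with hM
  have hM0 : 0 < M := Nat.ceil_pos.2 (by positivity)
  choose C hC using fun s => hcov s M (Nat.le_ceil _)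
  let T : S → (Fin n → U) → (Fin n → V) → Prop := fun s => Typical (fun a b => Q s a * W s a b) δ
  -- The search runs over the codebooks of all sources; a word that is covered by none is sent to an
  -- arbitrary index.
  let f : (Fin n → U) → S × Fin M := fun x =>
    if hx : ∃ k : S × Fin M, T k.1 x (C k.1 k.2) then hx.choose
    else (Classical.arbitrary S, ⟨0, hM0⟩)
  have hf : ∀ s x, (∃ j, T s x (C s j)) → T s x (C (f x).1 (f x).2) := by
    rintro s x ⟨j, hj⟩
    have hx : ∃ k : S × Fin M, T k.1 x (C k.1 k.2) := ⟨(s, j), hj⟩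
    have hfx : f x = hx.choose := dif_pos hx
    have hk := hx.choose_spec
    rw [← hfx] at hk
    -- Both `Q s` and `Q (f x).1` are within `δ * card V` of the empirical law of `x`, so separation
    -- identifies the source.
    have : s = (f x).1 := hsep _ _ fun a => by
      have t1 := hj.abs_marginal_sub_le (hW s) a
      have t2 := hk.abs_marginal_sub_le (hW _) a
      rw [abs_le] at t1 t2 ⊢
      constructor <;> linarith
    rw [← this] at hk ⊢
    exact hk
  let e := Fintype.equivFin (S × Fin M)
  refine ⟨Fintype.card (S × Fin M), fun x => e (f x), fun k => C (e.symm k).1 (e.symm k).2, ?_, ?_⟩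
  · rw [Fintype.card_prod, Fintype.card_fin]
    push_cast
    exact hrate
  · intro s h
    simp only [Equiv.symm_apply_apply]
    refine (abs_expect_sub_le (fun a b => mul_nonneg (hQ s a).le ((hW s a).1 b))
      (sum_joint (h1 s) (hW s)) (fun a => (hQ s a).le) (h1 s) hδ.le
      (fun x => C (f x).1 (f x).2) h).trans ?_
    refine mul_le_mul_of_nonneg_right ?_
      (Finset.sum_nonneg fun a _ => Finset.sum_nonneg fun b _ => abs_nonneg _)
    have : prob (fun x : Fin n → U => ∏ t, Q s (x t)) {x | ¬ T s x (C (f x).1 (f x).2)} ≤ ε / 2 := by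
      refine (prob_mono (fun x => Finset.prod_nonneg fun t _ => (hQ s _).le) ?_).trans (hC s)
      intro x hx j hj
      exact hx (hf s x ⟨j, hj⟩)
    linarith

end Achievability

/-! ### Converse -/

section Converse

variable {U V : Type*} [Fintype U] [Fintype V]

theorem sum_mul_log_le_log_sum {ι : Type*} [Fintype ι] {p z : ι → ℝ} (hp : ∀ i, 0 ≤ p i)
    (h1 : ∑ i, p i = 1) (hz : ∀ i, 0 < z i) :
    ∑ i, p i * Real.logb 2 (z i) ≤ Real.logb 2 (∑ i, p i * z i) := by
  have := strictConcaveOn_log_Ioi.concaveOn.le_map_sum (t := Finset.univ) (w := p) (p := z)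
    (fun i _ => hp i) h1 (fun i _ => hz i)
  simp only [smul_eq_mul] at this
  simp only [Real.logb, ← mul_div_assoc, ← Finset.sum_div]
  exact div_le_div_of_nonneg_right this (Real.log_pos (by norm_num)).le

/-- Termwise `1 - 1 / x ≤ log x`, and `r` has the same total mass as the product of its marginals.
-/
theorem mutualInfo_nonneg {r : U → V → ℝ} (hr : ∀ a b, 0 ≤ r a b)
    (h1 : ∑ a, ∑ b, r a b = 1) : 0 ≤ mutualInfo r := by
  set p : U → ℝ := fun a => ∑ b, r a b with hp
  set q : V → ℝ := fun b => ∑ a, r a b with hq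
  have hq1 : ∑ b, q b = 1 := by rw [hq, Finset.sum_comm]; exact h1
  have key : ∀ a b, (r a b - p a * q b) / Real.log 2 ≤ r a b * Real.logb 2 (r a b / (p a * q b)) := by
    intro a b
    have hpa : r a b ≤ p a := Finset.single_le_sum (f := fun b => r a b) (fun b _ => hr a b) (mem_univ b)
    have hqb : r a b ≤ q b := Finset.single_le_sum (f := fun a => r a b) (fun a _ => hr a b) (mem_univ a)
    have hl : 0 < Real.log 2 := Real.log_pos (by norm_num)
    rw [Real.logb, ← mul_div_assoc]
    refine div_le_div_of_nonneg_right ?_ hl.le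
    rcases (hr a b).eq_or_lt with h | h
    · rw [← h] at hpa hqb ⊢
      simpa using mul_nonneg hpa hqb
    · have h2 := h.trans_le hpa
      have h3 := h.trans_le hqb
      have := mul_le_mul_of_nonneg_left
        (Real.one_sub_inv_le_log_of_pos (show 0 < r a b / (p a * q b) by positivity)) h.le
      refine le_trans (le_of_eq ?_) this
      field_simp
  have : ∑ a, ∑ b, (r a b - p a * q b) / Real.log 2 ≤ mutualInfo r :=
    Finset.sum_le_sum fun a _ => Finset.sum_le_sum fun b _ => key a b
  refine le_trans (le_of_eq ?_) this
  simp only [← Finset.sum_div, Finset.sum_sub_distrib, ← Finset.mul_sum, h1, hq1, mul_one]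
  rw [show ∑ a, ∑ b, r a b = 1 from h1, sub_self, zero_div]

/-- The average joint pmf of a source letter and its reproduction. -/
noncomputable def avgJoint (Q : U → ℝ) {n : ℕ} (φ : (Fin n → U) → Fin n → V) (a : U) (b : V) : ℝ :=
  ∑ x : Fin n → U, (∏ t, Q (x t)) * jointType x (φ x) a b

theorem sum_avgJoint_mul (Q : U → ℝ) {n : ℕ} (φ : (Fin n → U) → Fin n → V) (h : U → V → ℝ) :
    ∑ a, ∑ b, avgJoint Q φ a b * h a b =
      ∑ x : Fin n → U, (∏ t, Q (x t)) * (1 / (n : ℝ) * ∑ t, h (x t) (φ x t)) := by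
  simp only [← sum_jointType_mul]
  simp only [avgJoint, Finset.sum_mul, Finset.mul_sum]
  calc _ = ∑ a, ∑ x : Fin n → U, ∑ b, (∏ t, Q (x t)) * jointType x (φ x) a b * h a b :=
        Finset.sum_congr rfl fun a _ => Finset.sum_comm
    _ = _ := by
      rw [Finset.sum_comm]
      simp only [mul_assoc]

/-- Every letter of the i.i.d. word has pmf `Q`, hence so does their time average. -/
theorem sum_avgJoint {Q : U → ℝ} (h1 : ∑ a, Q a = 1) {n : ℕ} (hn : 0 < n)
    (φ : (Fin n → U) → Fin n → V) (a : U) : ∑ b, avgJoint Q φ a b = Q a := by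
  classical
  have hn' : (n : ℝ) ≠ 0 := by exact_mod_cast hn.ne'
  have h := sum_avgJoint_mul Q φ fun a' _ => if a' = a then 1 else 0
  have e1 : ∑ a', ∑ b, avgJoint Q φ a' b * (if a' = a then (1 : ℝ) else 0) =
      ∑ b, avgJoint Q φ a b := by
    rw [Finset.sum_eq_single a]
    · simp
    · intro a' _ h
      simp [h]
    · simp
  rw [← e1, h]
  simp only [Finset.mul_sum]
  rw [Finset.sum_comm]
  have e2 : ∀ t : Fin n, ∑ x : Fin n → U, (∏ t, Q (x t)) * (1 / (n : ℝ) *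
      (if x t = a then (1 : ℝ) else 0)) = Q a * (1 / n) := fun t => by
    rw [sum_prod_mul_apply h1 t fun a' => 1 / (n : ℝ) * if a' = a then (1 : ℝ) else 0]
    simp
  simp only [e2]
  simp
  field_simp

/-- Single-letter converse: the rate of a block code is at least the mutual information of the
averaged joint pmf. -/
theorem mutualInfo_avgJoint_le {Q : U → ℝ} (hQ : ∀ a, 0 < Q a) (h1 : ∑ a, Q a = 1) {n J : ℕ}
    (hn : 0 < n) (enc : (Fin n → U) → Fin J) (dec : Fin J → Fin n → V) :
    mutualInfo (avgJoint Q fun x => dec (enc x)) ≤ 1 / (n : ℝ) * Real.logb 2 J := by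
  set φ : (Fin n → U) → Fin n → V := fun x => dec (enc x) with hφ
  set r := avgJoint Q φ with hr
  set q : V → ℝ := fun b => ∑ a, r a b with hq
  have hpQ : ∀ x : Fin n → U, 0 < ∏ t, Q (x t) := fun x => Finset.prod_pos fun t _ => hQ _
  have hr0 : ∀ a b, 0 ≤ r a b := fun a b =>
    Finset.sum_nonneg fun x _ => mul_nonneg (hpQ x).le (jointType_nonneg _ _ _ _)
  have hrpos : ∀ x t, 0 < r (x t) (φ x t) := fun x t =>
    lt_of_lt_of_le (mul_pos (hpQ x) (jointType_pos x (φ x) t))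
      (Finset.single_le_sum
        (f := fun x' : Fin n → U => (∏ s, Q (x' s)) * jointType x' (φ x') (x t) (φ x t))
        (fun x' _ => mul_nonneg (hpQ x').le (jointType_nonneg _ _ _ _)) (mem_univ x))
  have hqpos : ∀ x t, 0 < q (φ x t) := fun x t =>
    (hrpos x t).trans_le (Finset.single_le_sum (f := fun a => r a (φ x t))
      (fun a _ => hr0 a _) (mem_univ (x t)))
  have hzpos : ∀ x t, 0 < r (x t) (φ x t) / (Q (x t) * q (φ x t)) := fun x t =>
    div_pos (hrpos x t) (mul_pos (hQ _) (hqpos x t))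
  -- The information density is itself a letterwise cost, so its mean under `r` is an expectation
  -- over source words. Jensen's inequality then moves the logarithm outside.
  have hI : mutualInfo r = 1 / (n : ℝ) * ∑ x : Fin n → U, (∏ t, Q (x t)) *
      Real.logb 2 (∏ t, r (x t) (φ x t) / (Q (x t) * q (φ x t))) := by
    have : mutualInfo r = ∑ a, ∑ b, r a b * Real.logb 2 (r a b / (Q a * q b)) := by
      simp only [mutualInfo]
      simp only [hr, sum_avgJoint h1 hn φ, hq]
    rw [this, hr, sum_avgJoint_mul Q φ, Finset.mul_sum]
    refine Finset.sum_congr rfl fun x _ => ?_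
    rw [← hr, Real.logb_prod _ _ (fun t _ => (hzpos x t).ne')]
    ring
  rw [hI]
  refine mul_le_mul_of_nonneg_left ?_ (by positivity)
  refine (sum_mul_log_le_log_sum (fun x => (hpQ x).le) (sum_prod_eq_one h1)
    fun x => Finset.prod_pos fun t _ => hzpos x t).trans ?_
  have hne : Nonempty (Fin n → U) := by
    by_contra hcon
    rw [not_nonempty_iff] at hcon
    have := sum_prod_eq_one (n := n) h1
    simp at this
  refine Real.logb_le_logb_of_le (by norm_num)
    (Finset.sum_pos (fun x _ => mul_pos (hpQ x) (Finset.prod_pos fun t _ => hzpos x t))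
      Finset.univ_nonempty) ?_
  calc ∑ x : Fin n → U, (∏ t, Q (x t)) * ∏ t, r (x t) (φ x t) / (Q (x t) * q (φ x t))
      = ∑ x : Fin n → U, ∏ t, r (x t) (dec (enc x) t) / q (dec (enc x) t) := by
        refine Finset.sum_congr rfl fun x _ => ?_
        rw [← Finset.prod_mul_distrib]
        refine Finset.prod_congr rfl fun t _ => ?_
        have := (hQ (x t)).ne'
        have := (hqpos x t).ne'
        simp only [hφ] at this ⊢
        field_simp
    -- The codeword chosen by the encoder is bounded by the sum over all `J` codewords. For fixed
    -- `j` the sum over `x` factors, and each factor is the total mass of a conditional pmf of the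
    -- source letter, or `0` when `q` vanishes.
    _ ≤ ∑ x : Fin n → U, ∑ j, ∏ t, r (x t) (dec j t) / q (dec j t) := by
        refine Finset.sum_le_sum fun x _ => ?_
        exact Finset.single_le_sum (f := fun j => ∏ t, r (x t) (dec j t) / q (dec j t))
          (fun j _ => Finset.prod_nonneg fun t _ => div_nonneg (hr0 _ _)
            (Finset.sum_nonneg fun a _ => hr0 _ _)) (mem_univ (enc x))
    _ = ∑ j, ∏ t, ∑ a, r a (dec j t) / q (dec j t) := by
        rw [Finset.sum_comm]
        refine Finset.sum_congr rfl fun j _ => ?_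
        rw [← Fintype.prod_sum (fun (t : Fin n) a => r a (dec j t) / q (dec j t))]
    _ ≤ ∑ j : Fin J, 1 := by
        refine Finset.sum_le_sum fun j _ => Finset.prod_le_one (fun t _ => ?_) fun t _ => ?_
        · exact Finset.sum_nonneg fun a _ => div_nonneg (hr0 _ _)
            (Finset.sum_nonneg fun a _ => hr0 _ _)
        · rw [← Finset.sum_div]
          exact div_self_le_one _
    _ = J := by simp

/-- The channel is the conditional law of `avgJoint`. The cost identity is exact for every `h`, so
one channel serves all parameters of an atom. -/
theorem exists_channel_of_code {Q : U → ℝ} (hQ : ∀ a, 0 < Q a) (h1 : ∑ a, Q a = 1) {n J : ℕ}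
    (hn : 0 < n) (enc : (Fin n → U) → Fin J) (dec : Fin J → Fin n → V) :
    ∃ W ∈ Channel U V, mutualInfo (fun a b => Q a * W a b) ≤ 1 / (n : ℝ) * Real.logb 2 J ∧
      ∀ h : U → V → ℝ,
        ∑ x : Fin n → U, (∏ t, Q (x t)) * (1 / (n : ℝ) * ∑ t, h (x t) (dec (enc x) t)) =
          ∑ a, ∑ b, Q a * W a b * h a b := by
  set φ : (Fin n → U) → Fin n → V := fun x => dec (enc x) with hφ
  have e : ∀ a b, Q a * (avgJoint Q φ a b / Q a) = avgJoint Q φ a b := fun a b =>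
    mul_div_cancel₀ _ (hQ a).ne'
  refine ⟨fun a b => avgJoint Q φ a b / Q a, fun a => ⟨fun b => ?_, ?_⟩, ?_, fun h => ?_⟩
  · exact div_nonneg (Finset.sum_nonneg fun x _ => mul_nonneg
      (Finset.prod_nonneg fun t _ => (hQ _).le) (jointType_nonneg _ _ _ _)) (hQ a).le
  · rw [← Finset.sum_div, sum_avgJoint h1 hn, div_self (hQ a).ne']
  · simp only [e]
    exact mutualInfo_avgJoint_le hQ h1 hn enc dec
  · simp only [e]
    exact (sum_avgJoint_mul Q φ h).symm

end Converse

/-! ### Compactness -/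

section Compactness

variable {U V : Type*} [Fintype V]

theorem isCompact_channel : IsCompact (Channel U V) := by
  have : Channel U V = Set.univ.pi fun _ => stdSimplex ℝ V := by
    ext W; simp [Channel]
  rw [this]
  exact isCompact_univ_pi fun _ => isCompact_stdSimplex ℝ V

variable [Fintype U]

/-- In terms of `x log x`, which is continuous at `0`, continuity in the channel becomes evident
even on the boundary of the simplex. -/
theorem mutualInfo_eq {r : U → V → ℝ} (hr : ∀ a b, 0 ≤ r a b) :
    mutualInfo r = (∑ a, ∑ b, r a b * Real.log (r a b) -
      ∑ a, (∑ b, r a b) * Real.log (∑ b, r a b) -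
      ∑ b, (∑ a, r a b) * Real.log (∑ a, r a b)) / Real.log 2 := by
  have e : ∀ a b, r a b * Real.logb 2 (r a b / ((∑ b', r a b') * (∑ a', r a' b))) =
      (r a b * Real.log (r a b) - r a b * Real.log (∑ b', r a b') -
        r a b * Real.log (∑ a', r a' b)) / Real.log 2 := fun a b => by
    have hpa : r a b ≤ ∑ b', r a b' :=
      Finset.single_le_sum (f := fun b => r a b) (fun b _ => hr a b) (mem_univ b)
    have hqb : r a b ≤ ∑ a', r a' b :=
      Finset.single_le_sum (f := fun a => r a b) (fun a _ => hr a b) (mem_univ a)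
    rcases (hr a b).eq_or_lt with h | h
    · simp [← h]
    · rw [Real.logb, Real.log_div h.ne' (mul_pos (h.trans_le hpa) (h.trans_le hqb)).ne',
        Real.log_mul (h.trans_le hpa).ne' (h.trans_le hqb).ne']
      ring
  simp only [mutualInfo, e, ← Finset.sum_div, Finset.sum_sub_distrib, ← Finset.sum_mul]
  congr 2
  rw [Finset.sum_comm]
  simp only [← Finset.sum_mul]

theorem continuousOn_mutualInfo {Q : U → ℝ} (hQ : ∀ a, 0 ≤ Q a) :
    ContinuousOn (fun W : U → V → ℝ => mutualInfo fun a b => Q a * W a b) (Channel U V) := by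
  have : Set.EqOn (fun W : U → V → ℝ => mutualInfo fun a b => Q a * W a b)
      (fun W => (∑ a, ∑ b, (Q a * W a b) * Real.log (Q a * W a b) -
      ∑ a, (∑ b, Q a * W a b) * Real.log (∑ b, Q a * W a b) -
      ∑ b, (∑ a, Q a * W a b) * Real.log (∑ a, Q a * W a b)) / Real.log 2) (Channel U V) :=
    fun W hW => mutualInfo_eq fun a b => mul_nonneg (hQ a) ((hW a).1 b)
  refine ContinuousOn.congr (Continuous.continuousOn ?_) this
  have hc {f : (U → V → ℝ) → ℝ} (hf : Continuous f) : Continuous fun W => f W * Real.log (f W) :=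
    Real.continuous_mul_log.comp hf
  refine Continuous.div_const (Continuous.sub (Continuous.sub ?_ ?_) ?_) _
  · exact continuous_finsetSum _ fun a _ => continuous_finsetSum _ fun b _ =>
      hc (by fun_prop)
  · exact continuous_finsetSum _ fun a _ => hc (by fun_prop)
  · exact continuous_finsetSum _ fun b _ => hc (by fun_prop)

/-- A cluster point of the witnesses for `ε = 1 / (k + 1)` works for all constraints simultaneously.
This passes from slack `ε` in the definition of achievability to exact single-letter constraints. -/
theorem exists_forall_le_of_forall_pos {E ι : Type*} [TopologicalSpace E] [FirstCountableTopology E]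
    {K : Set E} (hK : IsCompact K) {F : ι → E → ℝ} (hF : ∀ i, ContinuousOn (F i) K) {c : ι → ℝ}
    (h : ∀ ε > 0, ∃ w ∈ K, ∀ i, F i w ≤ c i + ε) : ∃ w ∈ K, ∀ i, F i w ≤ c i := by
  choose w hwK hw using fun k : ℕ => h (1 / ((k : ℝ) + 1)) Nat.one_div_pos_of_nat
  obtain ⟨w₀, hw₀, ψ, hψ, lim⟩ := hK.tendsto_subseq hwK
  refine ⟨w₀, hw₀, fun i => ?_⟩
  have l1 : Tendsto (fun k => F i (w (ψ k))) atTop (nhds (F i w₀)) :=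
    (hF i w₀ hw₀).tendsto.comp
      (tendsto_nhdsWithin_iff.2 ⟨lim, Eventually.of_forall fun k => hwK _⟩)
  have l2 : Tendsto (fun k : ℕ => c i + 1 / (((ψ k : ℕ) : ℝ) + 1)) atTop (nhds (c i)) := by
    simpa using (tendsto_one_div_add_atTop_nhds_zero_nat (𝕜 := ℝ)).comp hψ.tendsto_atTop
      |>.const_add (c i)
  exact le_of_tendsto_of_tendsto' l1 l2 fun k => hw (ψ k) i

end Compactness

/-! ### Single-letter form of the distortion of a code -/

section Fiber

theorem sum_mul_average {α : Type*} [Fintype α] (w : α → ℝ) {n : ℕ} (h : α → Fin n → ℝ) :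
    ∑ x, w x * (1 / (n : ℝ) * ∑ t, h x t) = 1 / (n : ℝ) * ∑ t, ∑ x, w x * h x t := by
  rw [Finset.sum_comm, Finset.mul_sum]
  refine Finset.sum_congr rfl fun x _ => ?_
  rw [← Finset.mul_sum]
  ring

variable {Z U V : Type*} [Fintype Z] [Fintype U] [DecidableEq U]

/-- Averaging a letterwise cost over product words, when the reproduction depends on the word only
through its letterwise image under `π`. -/
theorem sum_prod_comp (p : Z → ℝ) (π : Z → U) (g : Z → V → ℝ) (p' : U → ℝ) (g' : U → V → ℝ)
    (hp' : ∀ a, p' a = ∑ z, if π z = a then p z else 0)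
    (hg' : ∀ a b, p' a * g' a b = ∑ z, if π z = a then p z * g z b else 0) {n : ℕ}
    (φ : (Fin n → U) → Fin n → V) :
    ∑ x : Fin n → Z, (∏ t, p (x t)) * (1 / (n : ℝ) * ∑ t, g (x t) (φ (fun s => π (x s)) t)) =
      ∑ u : Fin n → U, (∏ t, p' (u t)) * (1 / (n : ℝ) * ∑ t, g' (u t) (φ u t)) := by
  have key : ∀ t : Fin n, ∑ x : Fin n → Z, (∏ s, p (x s)) * g (x t) (φ (fun s => π (x s)) t) =
      ∑ u : Fin n → U, (∏ s, p' (u s)) * g' (u t) (φ u t) := by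
    intro t
    -- The condition that `u` is the image of `x` is written as a product of coordinatewise
    -- indicators, so that for fixed `u` the sum over `x` factors.
    have e1 : ∀ x : Fin n → Z, (∏ s, p (x s)) * g (x t) (φ (fun s => π (x s)) t) =
        ∑ u : Fin n → U, ∏ s, (if π (x s) = u s then
          p (x s) * (if s = t then g (x s) (φ u t) else 1) else 0) := fun x => by
      rw [Finset.sum_eq_single (fun s => π (x s))]
      · simp only [if_true]
        rw [Finset.prod_mul_distrib, Finset.prod_ite_eq']
        simp
      · intro u _ hu
        obtain ⟨s, hs⟩ := Function.ne_iff.1 hu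
        exact Finset.prod_eq_zero (mem_univ s) (if_neg fun h => hs h.symm)
      · simp
    simp only [e1]
    rw [Finset.sum_comm]
    refine Finset.sum_congr rfl fun u _ => ?_
    rw [← Fintype.prod_sum (fun (s : Fin n) z => if π z = u s then
      p z * (if s = t then g z (φ u t) else 1) else 0)]
    have e2 : ∀ s, ∑ z, (if π z = u s then p z * (if s = t then g z (φ u t) else 1) else 0) =
        p' (u s) * (if s = t then g' (u s) (φ u t) else 1) := fun s => by
      by_cases hs : s = t
      · simp only [hs, if_true, hg']
      · simp only [hs, if_false, mul_one, hp']
    simp only [e2]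
    rw [Finset.prod_mul_distrib, Finset.prod_ite_eq']
    simp
  rw [sum_mul_average, sum_mul_average]
  simp only [key]

end Fiber

theorem prob_setOf {Ω : Type*} [Fintype Ω] (p : Ω → ℝ) (C : Ω → Prop) [DecidablePred C] :
    prob p {ω | C ω} = ∑ ω, if C ω then p ω else 0 := by
  simp only [prob, Set.indicator, Set.mem_ofPred_eq]
  exact Finset.sum_congr rfl fun ω _ => by congr

/-! ### Sampled marginals and conditional mean distortion -/

section Source

variable {m : ℕ} {X Y : Fin m → Type*} {Θ : Type*}
variable [∀ i, Fintype (X i)]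

theorem marg_pos {p : (∀ i, X i) → ℝ} (hp : ∀ x, 0 < p x) (h1 : ∑ x, p x = 1)
    (A : Finset (Fin m)) (a : Sub X A) : 0 < marg A p a := by
  classical
  obtain ⟨x₀⟩ : Nonempty (∀ i, X i) := by
    by_contra hne
    rw [not_nonempty_iff] at hne
    simp at h1
  rw [marg, prob_setOf]
  refine Finset.sum_pos' (fun x _ => by split_ifs; exacts [(hp x).le, le_rfl])
    -- Any sampled value extends to a full source letter, which has positive mass.
    ⟨fun i => if h : i ∈ A then a ⟨i, h⟩ else x₀ i, mem_univ _, ?_⟩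
  rw [if_pos]
  · exact hp _
  · funext i
    simp [Finset.restrict]

theorem sum_marg (p : (∀ i, X i) → ℝ) (A : Finset (Fin m)) :
    ∑ a, marg A p a = ∑ x, p x := by
  classical
  simp only [marg, prob_setOf]
  rw [Finset.sum_comm]
  simp

open Classical in
/-- The conditional mean of `d(X_B, y)` given `X_A = a` when `X_M` has pmf `p`. -/
noncomputable def condDist (A B : Finset (Fin m)) (d : Sub X B → Sub Y B → ℝ)
    (p : (∀ i, X i) → ℝ) (a : Sub X A) (y : Sub Y B) : ℝ :=
  (∑ x, if A.restrict x = a then p x * d (B.restrict x) y else 0) / marg A p a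

open Classical in
theorem marg_mul_condDist {A B : Finset (Fin m)} {p : (∀ i, X i) → ℝ}
    (hA : ∀ a, 0 < marg A p a) (d : Sub X B → Sub Y B → ℝ) (a : Sub X A) (y : Sub Y B) :
    marg A p a * condDist A B d p a y =
      ∑ x, if A.restrict x = a then p x * d (B.restrict x) y else 0 :=
  mul_div_cancel₀ _ (hA a).ne'

theorem FSCode.distortion_eq {A B : Finset (Fin m)} {n : ℕ} (c : FSCode X Y A B n)
    (d : Sub X B → Sub Y B → ℝ) {p : (∀ i, X i) → ℝ} (hA : ∀ a, 0 < marg A p a) :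
    c.distortion d p = ∑ u : Fin n → Sub X A, (∏ t, marg A p (u t)) *
      (1 / (n : ℝ) * ∑ t, condDist A B d p (u t) (c.dec (c.enc u) t)) := by
  classical
  exact sum_prod_comp p (fun x => A.restrict x) (fun x y => d (B.restrict x) y) (marg A p)
    (condDist A B d p) (fun a => prob_setOf p _) (fun a b => marg_mul_condDist hA d a b)
    (fun u => c.dec (c.enc u))

variable [∀ i, Fintype (Y i)]

theorem chanDistortion_eq {A B : Finset (Fin m)} (d : Sub X B → Sub Y B → ℝ)
    {p : (∀ i, X i) → ℝ} (hA : ∀ a, 0 < marg A p a) (W : Sub X A → Sub Y B → ℝ) :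
    chanDistortion d p W = ∑ a, ∑ y, marg A p a * W a y * condDist A B d p a y := by
  classical
  have e : ∀ a y, marg A p a * W a y * condDist A B d p a y =
      ∑ x, if A.restrict x = a then p x * W (A.restrict x) y * d (B.restrict x) y else 0 := by
    intro a y
    rw [mul_right_comm, marg_mul_condDist hA, Finset.sum_mul]
    refine Finset.sum_congr rfl fun x _ => ?_
    split_ifs with h
    · rw [h]; ring
    · simp
  simp only [e, chanDistortion, expect]
  rw [Fintype.sum_prod_type_right]
  conv_rhs => rw [Finset.sum_comm]
  refine Finset.sum_congr rfl fun y _ => ?_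
  rw [Finset.sum_comm]
  simp

theorem continuous_chanDistortion {A B : Finset (Fin m)} (d : Sub X B → Sub Y B → ℝ)
    (p : (∀ i, X i) → ℝ) :
    Continuous fun W : Sub X A → Sub Y B → ℝ => chanDistortion d p W := by
  unfold chanDistortion expect
  fun_prop

/-! ### Codes and test channels for the ambiguity atoms -/

section Atoms

variable (P : Θ → (∀ i, X i) → ℝ) (A : Finset (Fin m))

theorem atomOf_surjective : Function.Surjective (atomOf P A) :=
  Quotient.mk_surjective

theorem atomMarg_atomOf (τ : Θ) : atomMarg P A (atomOf P A τ) = marg A (P τ) := rfl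

/-- This is what lets the encoder recognise the atom from the sampled word. -/
theorem atomMarg_injective : Function.Injective (atomMarg P A) := by
  intro s s'
  obtain ⟨τ, rfl⟩ := atomOf_surjective P A s
  obtain ⟨τ', rfl⟩ := atomOf_surjective P A s'
  exact fun h => Quotient.sound h

variable {P} (hP : ∀ τ x, 0 < P τ x) (hP1 : ∀ τ, ∑ x, P τ x = 1)

include hP hP1

theorem atomMarg_pos (s : Atom P A) (a : Sub X A) : 0 < atomMarg P A s a := by
  obtain ⟨τ, rfl⟩ := atomOf_surjective P A s
  exact marg_pos (hP τ) (hP1 τ) A a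

omit hP in
theorem sum_atomMarg (s : Atom P A) : ∑ a, atomMarg P A s a = 1 := by
  obtain ⟨τ, rfl⟩ := atomOf_surjective P A s
  exact (sum_marg (P τ) A).trans (hP1 τ)

theorem chanDistortion_eq_atom {B : Finset (Fin m)} (d : Sub X B → Sub Y B → ℝ) (τ : Θ)
    (W : Sub X A → Sub Y B → ℝ) :
    chanDistortion d (P τ) W =
      ∑ a, ∑ y, atomMarg P A (atomOf P A τ) a * W a y * condDist A B d (P τ) a y :=
  chanDistortion_eq d (marg_pos (hP τ) (hP1 τ) A) W

theorem exists_channel_of_fsCode {B : Finset (Fin m)} (d : Sub X B → Sub Y B → ℝ) {n : ℕ}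
    (hn : 0 < n) (c : FSCode X Y A B n) (s : Atom P A) :
    ∃ W ∈ Channel (Sub X A) (Sub Y B), infoPeak P A B s W ≤ c.rate ∧
      ∀ τ, atomOf P A τ = s → chanDistortion d (P τ) W = c.distortion d (P τ) := by
  obtain ⟨W, hW, hI, hd⟩ := exists_channel_of_code (atomMarg_pos A hP hP1 s)
    (sum_atomMarg A hP1 s) hn c.enc c.dec
  refine ⟨W, hW, hI, ?_⟩
  rintro τ rfl
  rw [chanDistortion_eq_atom A hP hP1, ← hd, c.distortion_eq d (marg_pos (hP τ) (hP1 τ) A)]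
  rfl

theorem eventually_exists_fsCode [Fintype Θ] [Nonempty Θ] {B : Finset (Fin m)} (d : Sub X B → Sub Y B → ℝ)
    {W : Atom P A → Sub X A → Sub Y B → ℝ} (hW : ∀ s, W s ∈ Channel (Sub X A) (Sub Y B))
    {R : ℝ} (hR0 : 0 ≤ R) (hR : ∀ s, infoPeak P A B s (W s) ≤ R) {ε : ℝ} (hε : 0 < ε) :
    ∀ᶠ n in atTop, ∃ c : FSCode X Y A B n, c.rate < R + ε ∧
      ∀ τ, c.distortion d (P τ) ≤ chanDistortion d (P τ) (W (atomOf P A τ)) + ε := by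
  have : Nonempty (Atom P A) := Nonempty.map (atomOf P A) inferInstance
  set k : Θ → ℝ := fun τ => ∑ a, ∑ y, |condDist A B d (P τ) a y| with hk
  have hk0 : ∀ τ, 0 ≤ k τ := fun τ =>
    Finset.sum_nonneg fun a _ => Finset.sum_nonneg fun y _ => abs_nonneg _
  have hs0 : 0 ≤ ∑ τ, k τ := Finset.sum_nonneg fun τ _ => hk0 τ
  -- One tolerance for all parameters: `ε' * k τ ≤ ε` for every `τ`, and also `ε' ≤ ε` for the rate.
  set ε' := ε / (1 + ∑ τ, k τ) with hε'
  have hpos : 0 < ε' := by positivity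
  have hmul : ε' * (1 + ∑ τ, k τ) = ε := div_mul_cancel₀ _ (by positivity)
  have hle : ε' ≤ ε := by nlinarith
  filter_upwards [eventually_exists_universal_code (atomMarg_pos A hP hP1) (sum_atomMarg A hP1)
    (atomMarg_injective P A) hW hR0 hR hpos] with n hn
  obtain ⟨J, enc, dec, hJ, hd⟩ := hn
  refine ⟨⟨J, enc, dec⟩, lt_of_lt_of_le hJ (by linarith), fun τ => ?_⟩
  rw [FSCode.distortion_eq _ d (marg_pos (hP τ) (hP1 τ) A), chanDistortion_eq_atom A hP hP1]
  have h := (le_abs_self _).trans (hd (atomOf P A τ) (condDist A B d (P τ)))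
  have h2 : ε' * k τ ≤ ε := by
    have := Finset.single_le_sum (f := k) (fun τ _ => hk0 τ) (mem_univ τ)
    nlinarith
  rw [atomMarg_atomOf] at h ⊢
  have h3 : ε' * ∑ a, ∑ y, |condDist A B d (P τ) a y| = ε' * k τ := rfl
  linarith

theorem infoPeak_nonneg {B : Finset (Fin m)} (s : Atom P A) {W : Sub X A → Sub Y B → ℝ}
    (hW : W ∈ Channel (Sub X A) (Sub Y B)) : 0 ≤ infoPeak P A B s W :=
  mutualInfo_nonneg (fun a y => mul_nonneg (atomMarg_pos A hP hP1 s a).le ((hW a).1 y))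
    (sum_joint (sum_atomMarg A hP1 s) hW)

theorem continuousOn_infoPeak {B : Finset (Fin m)} (s : Atom P A) :
    ContinuousOn (infoPeak P A B s) (Channel (Sub X A) (Sub Y B)) :=
  continuousOn_mutualInfo fun a => (atomMarg_pos A hP hP1 s a).le

/-- A continuous function on a closed subset of a compact set. The index `ι` allows one averaged
constraint (Bayesian) or one for each parameter of the atom (nonBayesian). -/
theorem exists_infoPeak_min {B : Finset (Fin m)} (s : Atom P A) {ι : Type*}
    {F : ι → (Sub X A → Sub Y B → ℝ) → ℝ} (hF : ∀ i, Continuous (F i)) {δ : ℝ}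
    (hne : ∃ W ∈ Channel (Sub X A) (Sub Y B), ∀ i, F i W ≤ δ) :
    ∃ W ∈ Channel (Sub X A) (Sub Y B), (∀ i, F i W ≤ δ) ∧
      ∀ W' ∈ Channel (Sub X A) (Sub Y B), (∀ i, F i W' ≤ δ) →
        infoPeak P A B s W ≤ infoPeak P A B s W' := by
  have hc : IsClosed {W : Sub X A → Sub Y B → ℝ | ∀ i, F i W ≤ δ} := by
    rw [Set.ofPred_forall]
    exact isClosed_iInter fun i => isClosed_le (hF i) continuous_const
  obtain ⟨W₀, hW₀, hW₀'⟩ := hne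
  obtain ⟨W, hW, hmin⟩ := (isCompact_channel.inter_right hc).exists_isMinOn ⟨W₀, hW₀, hW₀'⟩
    ((continuousOn_infoPeak A hP hP1 s).mono Set.inter_subset_left)
  exact ⟨W, hW.1, hW.2, fun W' h h' => hmin ⟨h, h'⟩⟩

end Atoms

end Source

/-! ### The Bayesian constraint sets in terms of channels -/

section CondProb

variable {Ω α β : Type*} [Fintype Ω] [Fintype α] [Fintype β]

theorem sum_condProb_mul (p : Ω → ℝ) (E : Set Ω) (u : Ω → α) (v : Ω → β) (g : α → β → ℝ) :
    ∑ a, ∑ b, condProb p {ω | u ω = a ∧ v ω = b} E * g a b =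
      condExpect p E fun ω => g (u ω) (v ω) := by
  classical
  simp only [condProb, condExpect, prob, Set.indicator, div_mul_eq_mul_div, ← Finset.sum_div]
  congr 1
  simp only [Finset.sum_mul]
  rw [Finset.sum_congr rfl fun a _ => Finset.sum_comm, Finset.sum_comm]
  refine Finset.sum_congr rfl fun ω _ => ?_
  by_cases h : ω ∈ E
  · simp [h, ite_and]
  · simp [h]

end CondProb

section Bayes

variable {m : ℕ} {X Y : Fin m → Type*} {Θ : Type*}
variable [∀ i, Fintype (X i)] [Fintype Θ]
variable (P : Θ → (∀ i, X i) → ℝ) (μ : Θ → ℝ) (A : Finset (Fin m))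

open Classical in
theorem atomPmf_eq (s : Atom P A) : atomPmf P μ A s = ∑ τ, if atomOf P A τ = s then μ τ else 0 :=
  prob_setOf μ fun τ => atomOf P A τ = s

open Classical in
-- The tower property over atoms: the atoms partition `Θ`.
theorem expect_atomPmf_of_mul {D : Atom P A → ℝ} {f : Θ → ℝ}
    (h : ∀ s, atomPmf P μ A s * D s = ∑ τ, if atomOf P A τ = s then f τ else 0) :
    expect (atomPmf P μ A) D = ∑ τ, f τ := by
  simp only [expect, h]
  rw [Finset.sum_comm]
  simp

variable {P} {μ} in
open Classical in
theorem prob_source_inter (s : Atom P A) (a : Sub X A) :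
    prob (source P μ) {ω | A.restrict ω.2 = a ∧ atomOf P A ω.1 = s} =
      atomPmf P μ A s * atomMarg P A s a := by
  rw [prob_setOf, Fintype.sum_prod_type, atomPmf_eq, Finset.sum_mul]
  refine Finset.sum_congr rfl fun τ _ => ?_
  split_ifs with h
  · subst h
    rw [atomMarg_atomOf, marg, prob_setOf, Finset.mul_sum]
    refine Finset.sum_congr rfl fun x _ => ?_
    by_cases hx : A.restrict x = a <;> simp [hx, source]
  · simp [h]

open Classical in
theorem prob_source_atom (hP1 : ∀ τ, ∑ x, P τ x = 1) (s : Atom P A) :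
    prob (source P μ) {ω | atomOf P A ω.1 = s} = atomPmf P μ A s := by
  rw [prob_setOf, Fintype.sum_prod_type, atomPmf_eq]
  refine Finset.sum_congr rfl fun τ _ => ?_
  split_ifs with h
  · simp only [source, ← Finset.mul_sum, hP1, mul_one]
  · simp

variable {P} {μ} (hP : ∀ τ x, 0 < P τ x) (hP1 : ∀ τ, ∑ x, P τ x = 1) (hμ : ∀ τ, 0 < μ τ)

include hμ in
theorem atomPmf_pos (s : Atom P A) : 0 < atomPmf P μ A s := by
  classical
  obtain ⟨τ, rfl⟩ := atomOf_surjective P A s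
  rw [atomPmf_eq]
  exact Finset.sum_pos' (fun τ _ => by split_ifs; exacts [(hμ τ).le, le_rfl])
    ⟨τ, mem_univ τ, by simpa using hμ τ⟩

include hP1 hμ in
open Classical in
theorem atomPmf_mul_condExpect (s : Atom P A) (f : Θ × (∀ i, X i) → ℝ) :
    atomPmf P μ A s * condExpect (source P μ) {ω | atomOf P A ω.1 = s} f =
      ∑ τ, if atomOf P A τ = s then ∑ x, source P μ (τ, x) * f (τ, x) else 0 := by
  rw [condExpect, prob_source_atom P μ A hP1, mul_div_cancel₀ _ (atomPmf_pos A hμ s).ne',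
    Fintype.sum_prod_type]
  refine Finset.sum_congr rfl fun τ _ => ?_
  by_cases h : atomOf P A τ = s <;> simp [Set.indicator, h]

variable {B : Finset (Fin m)} (d : Sub X B → Sub Y B → ℝ)

include hP1 hμ in
theorem deltaMinBayes_eq : deltaMinBayes P μ A B d = expect (source P μ) (fun ω =>
    ⨅ y, dAtom P μ A B d (atomOf P A ω.1) (A.restrict ω.2) y) := by
  classical
  rw [deltaMinBayes, expect_atomPmf_of_mul P μ A (f := fun τ => ∑ x, source P μ (τ, x) *
    ⨅ y, dAtom P μ A B d (atomOf P A τ) (A.restrict x) y), expect, Fintype.sum_prod_type]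
  intro s
  rw [atomPmf_mul_condExpect A hP1 hμ]
  refine Finset.sum_congr rfl fun τ _ => ?_
  split_ifs with h
  · rw [h]
  · rfl

include hP hP1 hμ in
open Classical in
-- Inside an atom `X_A` carries no information on `θ`, so `dAtom` averages `condDist` over the atom
-- with weights proportional to `μ`.
theorem atomPmf_mul_dAtom (s : Atom P A) (a : Sub X A) (y : Sub Y B) :
    atomPmf P μ A s * (atomMarg P A s a * dAtom P μ A B d s a y) =
      ∑ τ, if atomOf P A τ = s then μ τ * (atomMarg P A s a * condDist A B d (P τ) a y) else 0 := by
  rw [← mul_assoc, dAtom, condExpect, prob_source_inter A,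
    mul_div_cancel₀ _ (mul_pos (atomPmf_pos A hμ s) (atomMarg_pos A hP hP1 s a)).ne',
    Fintype.sum_prod_type]
  refine Finset.sum_congr rfl fun τ _ => ?_
  split_ifs with h
  · subst h
    rw [atomMarg_atomOf, marg_mul_condDist (marg_pos (hP τ) (hP1 τ) A), Finset.mul_sum]
    refine Finset.sum_congr rfl fun x _ => ?_
    by_cases hx : A.restrict x = a <;> simp [hx, source, Set.indicator, mul_assoc]
  · simp [h, Set.indicator]

variable [∀ i, Fintype (Y i)]

variable (P) (μ) in
/-- `E[d_{τ₁}(X_A, Y_B) | θ₁ = τ₁]` when `P_{Y_B | X_A, θ₁ = τ₁} = W`. -/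
noncomputable def atomDistortion (s : Atom P A) (W : Sub X A → Sub Y B → ℝ) : ℝ :=
  ∑ a, ∑ y, atomMarg P A s a * W a y * dAtom P μ A B d s a y

theorem continuous_atomDistortion (s : Atom P A) :
    Continuous fun W : Sub X A → Sub Y B → ℝ => atomDistortion P μ A d s W := by
  unfold atomDistortion
  fun_prop

include hP hP1 hμ in
-- This links the budget split among atoms in the formula with the average over `θ` in the
-- operational criterion.
theorem expect_atomDistortion (W : Atom P A → Sub X A → Sub Y B → ℝ) :
    expect (atomPmf P μ A) (fun s => atomDistortion P μ A d s (W s)) =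
      expect μ fun τ => chanDistortion d (P τ) (W (atomOf P A τ)) := by
  classical
  refine expect_atomPmf_of_mul P μ A fun s => ?_
  have e : ∀ a y, atomPmf P μ A s * (atomMarg P A s a * W s a y * dAtom P μ A B d s a y) =
      ∑ τ, W s a y * if atomOf P A τ = s then
        μ τ * (atomMarg P A s a * condDist A B d (P τ) a y) else 0 := fun a y => by
    rw [← Finset.mul_sum, ← atomPmf_mul_dAtom A hP hP1 hμ]
    ring
  simp only [atomDistortion, Finset.mul_sum, e]
  calc _ = ∑ a, ∑ τ, ∑ y, W s a y * (if atomOf P A τ = s then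
        μ τ * (atomMarg P A s a * condDist A B d (P τ) a y) else 0) :=
        Finset.sum_congr rfl fun a _ => Finset.sum_comm
    _ = _ := by
      rw [Finset.sum_comm]
      refine Finset.sum_congr rfl fun τ _ => ?_
      split_ifs with h
      · subst h
        rw [chanDistortion_eq_atom A hP hP1, Finset.mul_sum]
        refine Finset.sum_congr rfl fun a _ => ?_
        rw [Finset.mul_sum]
        refine Finset.sum_congr rfl fun y _ => ?_
        ring
      · simp

/-! #### From joint pmfs to channels -/

section Joint

variable {Q : Θ × (∀ i, X i) × Sub Y B → ℝ}

omit [Fintype Θ] in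
theorem sum_ite_joint (hQ : ∀ τ x, ∑ y, Q (τ, x, y) = source P μ (τ, x))
    (C : Θ → (∀ i, X i) → Prop) [∀ τ x, Decidable (C τ x)] (τ : Θ) :
    ∑ ω : (∀ i, X i) × Sub Y B, (if C τ ω.1 then Q (τ, ω) else 0) =
      ∑ x, if C τ x then source P μ (τ, x) else 0 := by
  rw [Fintype.sum_prod_type]
  refine Finset.sum_congr rfl fun x _ => ?_
  split_ifs
  · exact hQ τ x
  · simp

theorem prob_joint_atom (hP1 : ∀ τ, ∑ x, P τ x = 1)
    (hQ : ∀ τ x, ∑ y, Q (τ, x, y) = source P μ (τ, x)) (s : Atom P A) :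
    prob Q {ω | atomOf P A ω.1 = s} = atomPmf P μ A s := by
  classical
  rw [← prob_source_atom P μ A hP1, prob_setOf, prob_setOf, Fintype.sum_prod_type,
    Fintype.sum_prod_type]
  exact Finset.sum_congr rfl fun τ _ => sum_ite_joint hQ (fun τ _ => atomOf P A τ = s) τ

include hP1 hμ in
theorem sum_condProb_joint (hQ : ∀ τ x, ∑ y, Q (τ, x, y) = source P μ (τ, x)) (s : Atom P A)
    (a : Sub X A) :
    ∑ y, condProb Q {ω | A.restrict ω.2.1 = a ∧ ω.2.2 = y} {ω | atomOf P A ω.1 = s} =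
      atomMarg P A s a := by
  classical
  have h := sum_condProb_mul Q {ω | atomOf P A ω.1 = s} (fun ω => A.restrict ω.2.1)
    (fun ω => ω.2.2) (fun a' _ => if a' = a then 1 else 0)
  have e : ∑ a', ∑ y, condProb Q {ω | A.restrict ω.2.1 = a' ∧ ω.2.2 = y}
      {ω | atomOf P A ω.1 = s} * (if a' = a then (1 : ℝ) else 0) =
      ∑ y, condProb Q {ω | A.restrict ω.2.1 = a ∧ ω.2.2 = y} {ω | atomOf P A ω.1 = s} := by
    rw [Finset.sum_eq_single a]
    · simp
    · intro a' _ h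
      simp [h]
    · simp
  rw [← e, h, condExpect, prob_joint_atom A hP1 hQ, div_eq_iff (atomPmf_pos A hμ s).ne',
    mul_comm, ← prob_source_inter A, prob_setOf, Fintype.sum_prod_type, Fintype.sum_prod_type]
  refine Finset.sum_congr rfl fun τ _ => ?_
  refine Eq.trans ?_ (sum_ite_joint hQ (fun τ x => A.restrict x = a ∧ atomOf P A τ = s) τ)
  refine Finset.sum_congr rfl fun ω _ => ?_
  by_cases h1 : atomOf P A τ = s <;> by_cases h2 : A.restrict ω.1 = a <;>
    simp [Set.indicator, h1, h2]

include hP hP1 hμ in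
-- Cost and information depend on `Q` only through the conditional law of `(X_A, Y_B)` given the
-- atom; dividing by the marginal of `X_A` recovers a channel.
theorem exists_channel_of_mem_kappaBayes {δ : ℝ} {s : Atom P A}
    (hQ : Q ∈ kappaBayes P μ A B d δ s) :
    ∃ W ∈ Channel (Sub X A) (Sub Y B), atomDistortion P μ A d s W ≤ δ ∧
      infoPeak P A B s W = infoBayes P A B s Q := by
  obtain ⟨hQs, hQm, -, hQd⟩ := hQ
  set j : Sub X A → Sub Y B → ℝ := fun a y =>
    condProb Q {ω | A.restrict ω.2.1 = a ∧ ω.2.2 = y} {ω | atomOf P A ω.1 = s} with hj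
  have e : ∀ a y, atomMarg P A s a * (j a y / atomMarg P A s a) = j a y := fun a y =>
    mul_div_cancel₀ _ (atomMarg_pos A hP hP1 s a).ne'
  refine ⟨fun a y => j a y / atomMarg P A s a, fun a => ⟨fun y => ?_, ?_⟩, ?_, ?_⟩
  · exact div_nonneg (div_nonneg (prob_nonneg hQs.1 _) (prob_nonneg hQs.1 _))
      (atomMarg_pos A hP hP1 s a).le
  · rw [← Finset.sum_div, sum_condProb_joint A hP1 hμ hQm,
      div_self (atomMarg_pos A hP hP1 s a).ne']
  · simp only [atomDistortion, e]
    exact (sum_condProb_mul Q {ω | atomOf P A ω.1 = s} (fun ω => A.restrict ω.2.1)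
      (fun ω => ω.2.2) (dAtom P μ A B d s)).trans_le hQd
  · simp only [infoPeak, e]
    rfl

end Joint

/-! #### From channels to joint pmfs -/

section OfChannel

variable {W : Sub X A → Sub Y B → ℝ}

variable (P) (μ) (W) in
/-- The joint pmf of `(θ, X_M, Y_B)` when `Y_B` is generated from `X_A` by the channel `W`. -/
def jointOfChannel (ω : Θ × (∀ i, X i) × Sub Y B) : ℝ :=
  source P μ (ω.1, ω.2.1) * W (A.restrict ω.2.1) ω.2.2

omit [∀ i, Fintype (X i)] [Fintype Θ] in
theorem sum_jointOfChannel (hW : W ∈ Channel (Sub X A) (Sub Y B)) (τ : Θ) (x : ∀ i, X i) :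
    ∑ y, jointOfChannel P μ A W (τ, x, y) = source P μ (τ, x) := by
  simp only [jointOfChannel, ← Finset.mul_sum]
  rw [(hW _).2, mul_one]

open Classical in
theorem prob_jointOfChannel (W : Sub X A → Sub Y B → ℝ) (C : Θ → (∀ i, X i) → Prop) {a : Sub X A}
    (hC : ∀ τ x, C τ x → A.restrict x = a) (y : Sub Y B) :
    prob (jointOfChannel P μ A W) {ω | C ω.1 ω.2.1 ∧ ω.2.2 = y} =
      prob (source P μ) {ω | C ω.1 ω.2} * W a y := by
  rw [prob_setOf, prob_setOf, Fintype.sum_prod_type, Fintype.sum_prod_type, Finset.sum_mul]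
  refine Finset.sum_congr rfl fun τ _ => ?_
  rw [Fintype.sum_prod_type, Finset.sum_mul]
  refine Finset.sum_congr rfl fun x _ => ?_
  by_cases h : C τ x
  · simp [h, jointOfChannel, hC τ x h]
  · simp [h]

theorem prob_jointOfChannel_left (hW : W ∈ Channel (Sub X A) (Sub Y B))
    (C : Θ → (∀ i, X i) → Prop) :
    prob (jointOfChannel P μ A W) {ω | C ω.1 ω.2.1} = prob (source P μ) {ω | C ω.1 ω.2} := by
  classical
  rw [prob_setOf, prob_setOf, Fintype.sum_prod_type, Fintype.sum_prod_type]
  exact Finset.sum_congr rfl fun τ _ => sum_ite_joint (sum_jointOfChannel A hW) C τ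

/-- Each probability involving `y` is a source probability times `W a y`, so both sides are the same
product. -/
theorem isMarkov_jointOfChannel (hW : W ∈ Channel (Sub X A) (Sub Y B)) :
    IsMarkov (jointOfChannel P μ A W) (fun ω => (ω.1, ω.2.1))
      (fun ω => (atomOf P A ω.1, A.restrict ω.2.1)) (fun ω => ω.2.2) := by
  rintro ⟨τ, x⟩ ⟨s, a⟩ y
  have e1 := prob_jointOfChannel (P := P) (μ := μ) A W
    (fun τ' x' => (τ', x') = (τ, x) ∧ (atomOf P A τ', A.restrict x') = (s, a))
    (fun τ' x' h => congrArg Prod.snd h.2) y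
  have e2 := prob_jointOfChannel (P := P) (μ := μ) A W
    (fun τ' x' => (atomOf P A τ', A.restrict x') = (s, a))
    (fun τ' x' h => congrArg Prod.snd h) y
  have e3 := prob_jointOfChannel_left (P := P) (μ := μ) A hW
    (fun τ' x' => (τ', x') = (τ, x) ∧ (atomOf P A τ', A.restrict x') = (s, a))
  have e4 := prob_jointOfChannel_left (P := P) (μ := μ) A hW
    (fun τ' x' => (atomOf P A τ', A.restrict x') = (s, a))
  simp only [and_assoc] at e1
  simp only []
  rw [e1, e2, e3, e4]
  ring

include hP1 hμ in
theorem condProb_jointOfChannel (hW : W ∈ Channel (Sub X A) (Sub Y B)) (s : Atom P A) (a : Sub X A)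
    (y : Sub Y B) :
    condProb (jointOfChannel P μ A W) {ω | A.restrict ω.2.1 = a ∧ ω.2.2 = y}
      {ω | atomOf P A ω.1 = s} = atomMarg P A s a * W a y := by
  have hset : ({ω | A.restrict ω.2.1 = a ∧ ω.2.2 = y} ∩ {ω | atomOf P A ω.1 = s} :
      Set (Θ × (∀ i, X i) × Sub Y B)) =
      {ω | (A.restrict ω.2.1 = a ∧ atomOf P A ω.1 = s) ∧ ω.2.2 = y} := by
    ext ω
    simp only [Set.mem_inter_iff, Set.mem_ofPred_eq]
    tauto
  have e := prob_jointOfChannel (P := P) (μ := μ) A W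
    (fun τ x => A.restrict x = a ∧ atomOf P A τ = s) (fun τ x h => h.1) y
  rw [condProb, hset, prob_joint_atom A hP1 (sum_jointOfChannel A hW), e, prob_source_inter A,
    div_eq_iff (atomPmf_pos A hμ s).ne']
  ring

include hP hP1 hμ in
theorem jointOfChannel_mem_kappaBayes (hμ1 : ∑ τ, μ τ = 1)
    (hW : W ∈ Channel (Sub X A) (Sub Y B)) {δ : ℝ} {s : Atom P A}
    (hδ : atomDistortion P μ A d s W ≤ δ) :
    jointOfChannel P μ A W ∈ kappaBayes P μ A B d δ s := by
  refine ⟨⟨fun ω => ?_, ?_⟩, sum_jointOfChannel A hW, isMarkov_jointOfChannel A hW, ?_⟩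
  · exact mul_nonneg (mul_nonneg (hμ _).le (hP _ _).le) ((hW _).1 _)
  · rw [Fintype.sum_prod_type]
    simp only [Fintype.sum_prod_type, sum_jointOfChannel A hW, source, ← Finset.mul_sum, hP1,
      mul_one, hμ1]
  · refine le_of_eq_of_le ?_ hδ
    refine (sum_condProb_mul (jointOfChannel P μ A W) {ω | atomOf P A ω.1 = s} (fun ω => A.restrict ω.2.1)
      (fun ω => ω.2.2) (dAtom P μ A B d s)).symm.trans ?_
    simp only [condProb_jointOfChannel A hP1 hμ hW, atomDistortion]

include hP1 hμ in
theorem infoBayes_jointOfChannel (hW : W ∈ Channel (Sub X A) (Sub Y B)) (s : Atom P A) :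
    infoBayes P A B s (jointOfChannel P μ A W) = infoPeak P A B s W := by
  simp only [infoBayes, infoPeak, condProb_jointOfChannel A hP1 hμ hW]

end OfChannel

/-! ### The Bayesian setting -/

include hP hP1 hμ

/-- The minimum defining `rhoBayes` is attained, by a joint pmf generated by a channel. -/
theorem exists_channel_rhoBayes_eq (hμ1 : ∑ τ, μ τ = 1) {δ : ℝ} {s : Atom P A}
    (hne : (kappaBayes P μ A B d δ s).Nonempty) :
    ∃ W ∈ Channel (Sub X A) (Sub Y B), atomDistortion P μ A d s W ≤ δ ∧
      rhoBayes P μ A B d δ s = (infoPeak P A B s W : EReal) := by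
  obtain ⟨Q₀, hQ₀⟩ := hne
  obtain ⟨W₀, hW₀, hd₀, -⟩ := exists_channel_of_mem_kappaBayes A hP hP1 hμ d hQ₀
  obtain ⟨W, hW, hd, hmin⟩ := exists_infoPeak_min A hP hP1 s (ι := Unit)
    (F := fun _ => atomDistortion P μ A d s) (fun _ => continuous_atomDistortion A d s) (δ := δ)
    ⟨W₀, hW₀, fun _ => hd₀⟩
  refine ⟨W, hW, hd (), le_antisymm ?_ (le_iInf₂ fun Q hQ => ?_)⟩
  · rw [← infoBayes_jointOfChannel A hP1 hμ hW]
    exact iInf₂_le _ (jointOfChannel_mem_kappaBayes A hP hP1 hμ d hμ1 hW (hd ()))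
  · obtain ⟨W', hW', hd', hI⟩ := exists_channel_of_mem_kappaBayes A hP hP1 hμ d hQ
    rw [← hI]
    exact_mod_cast hmin W' hW' fun _ => hd'

theorem rhoBayes_le (hμ1 : ∑ τ, μ τ = 1) {s : Atom P A} {W : Sub X A → Sub Y B → ℝ}
    (hW : W ∈ Channel (Sub X A) (Sub Y B)) {δ : ℝ} (hd : atomDistortion P μ A d s W ≤ δ) :
    rhoBayes P μ A B d δ s ≤ (infoPeak P A B s W : EReal) := by
  rw [← infoBayes_jointOfChannel A hP1 hμ hW]
  exact iInf₂_le _ (jointOfChannel_mem_kappaBayes A hP hP1 hμ d hμ1 hW hd)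

theorem achievableBayes_of_channels [Nonempty Θ] (hμ1 : ∑ τ, μ τ = 1)
    {W : Atom P A → Sub X A → Sub Y B → ℝ}
    (hW : ∀ s, W s ∈ Channel (Sub X A) (Sub Y B)) {R Δ : ℝ} (hR0 : 0 ≤ R)
    (hR : ∀ s, infoPeak P A B s (W s) ≤ R)
    (hΔ : expect (atomPmf P μ A) (fun s => atomDistortion P μ A d s (W s)) ≤ Δ) :
    AchievableBayes P μ A B d Δ R := by
  refine ⟨hR0, fun ε hε => ?_⟩
  filter_upwards [eventually_exists_fsCode A hP hP1 d hW hR0 hR hε] with n hn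
  obtain ⟨c, hc, hd⟩ := hn
  refine ⟨c, hc, ?_⟩
  rw [expect_atomDistortion A hP hP1 hμ] at hΔ
  have h1 : expect μ (fun τ => c.distortion d (P τ)) ≤
      ∑ τ, (μ τ * chanDistortion d (P τ) (W (atomOf P A τ)) + μ τ * ε) :=
    Finset.sum_le_sum fun τ _ => by
      rw [← mul_add]
      exact mul_le_mul_of_nonneg_left (hd τ) (hμ τ).le
  rw [Finset.sum_add_distrib, ← Finset.sum_mul, hμ1, one_mul] at h1
  rw [expect] at hΔ
  linarith

theorem exists_channels_of_achievableBayes {R Δ : ℝ} (h : AchievableBayes P μ A B d Δ R) :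
    ∃ W : Atom P A → Sub X A → Sub Y B → ℝ, (∀ s, W s ∈ Channel (Sub X A) (Sub Y B)) ∧
      (∀ s, infoPeak P A B s (W s) ≤ R) ∧
      expect (atomPmf P μ A) (fun s => atomDistortion P μ A d s (W s)) ≤ Δ := by
  have hK : IsCompact (Set.univ.pi fun _ : Atom P A => Channel (Sub X A) (Sub Y B)) :=
    isCompact_univ_pi fun _ => isCompact_channel
  -- The index `none` carries the averaged distortion and `some s` the rate constraint of atom `s`.
  -- Since the distortion couples the atoms, the limit is taken in the product of the channel
  -- spaces.
  let F : Option (Atom P A) → (Atom P A → Sub X A → Sub Y B → ℝ) → ℝ := fun i W =>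
    i.elim (expect (atomPmf P μ A) fun s => atomDistortion P μ A d s (W s))
      fun s => infoPeak P A B s (W s)
  obtain ⟨W, hW, hF⟩ := exists_forall_le_of_forall_pos hK (F := F)
    (c := fun i => i.elim Δ fun _ => R) (by
      rintro (_ | s)
      · refine Continuous.continuousOn (continuous_finsetSum _ fun s _ => ?_)
        exact continuous_const.mul ((continuous_atomDistortion A d s).comp (continuous_apply s))
      · exact (continuousOn_infoPeak A hP hP1 s).comp (continuous_apply s).continuousOn
          fun W hW => hW s (Set.mem_univ s)) (by
      intro ε hε
      obtain ⟨n, ⟨c, hc, hcd⟩, hn⟩ := ((h.2 ε hε).and (eventually_gt_atTop 0)).exists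
      choose W hW hI hd using exists_channel_of_fsCode A hP hP1 d hn c
      refine ⟨W, fun s _ => hW s, ?_⟩
      rintro (_ | s)
      · simp only [F, Option.elim_none]
        rw [expect_atomDistortion A hP hP1 hμ]
        simpa only [hd _ _ rfl] using hcd
      · exact (hI s).trans hc.le)
  exact ⟨W, fun s => hW s (Set.mem_univ s), fun s => hF (some s), hF none⟩

theorem usrdfBayes_le_iSup [Nonempty Θ] (hμ1 : ∑ τ, μ τ = 1) {Δ : ℝ} {D : Atom P A → ℝ}
    (hD : expect (atomPmf P μ A) D ≤ Δ) :
    usrdfBayes P μ A B d Δ ≤ ⨆ s, rhoBayes P μ A B d (D s) s := by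
  by_cases htop : ∀ s, (kappaBayes P μ A B d (D s) s).Nonempty
  · choose W hW hd hrho using fun s => exists_channel_rhoBayes_eq A hP hP1 hμ d hμ1 (htop s)
    have : Nonempty (Atom P A) := Nonempty.map (atomOf P A) inferInstance
    obtain ⟨s₀, hs₀⟩ := Finite.exists_max fun s => infoPeak P A B s (W s)
    have hach := achievableBayes_of_channels A hP hP1 hμ d hμ1 hW (Δ := Δ)
      (infoPeak_nonneg A hP hP1 s₀ (hW s₀)) hs₀
      (le_trans (Finset.sum_le_sum fun s _ =>
        mul_le_mul_of_nonneg_left (hd s) (atomPmf_pos A hμ s).le) hD)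
    refine (iInf₂_le _ hach).trans ?_
    rw [← hrho s₀]
    exact le_iSup (fun s => rhoBayes P μ A B d (D s) s) s₀
  -- An empty constraint set at one atom makes the supremum `⊤`.
  · push Not at htop
    obtain ⟨s, hs⟩ := htop
    refine le_top.trans (le_of_eq_of_le ?_ (le_iSup (fun s => rhoBayes P μ A B d (D s) s) s))
    simp [rhoBayes, hs]

theorem isLeast_usrdfBayes [Nonempty Θ] (hμ1 : ∑ τ, μ τ = 1) (Δ : ℝ) :
    IsLeast {v : EReal | ∃ D : Atom P A → ℝ, expect (atomPmf P μ A) D ≤ Δ ∧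
      v = ⨆ s, rhoBayes P μ A B d (D s) s} (usrdfBayes P μ A B d Δ) := by
  refine ⟨?_, ?_⟩
  · by_cases hne : ∃ R, AchievableBayes P μ A B d Δ R
    · set T : Set ℝ := {R | AchievableBayes P μ A B d Δ R} with hT
      have hbdd : BddBelow T := ⟨0, fun R hR => hR.1⟩
      -- The infimum is itself achievable: half of `ε` pays for approaching it, the other half for
      -- the code.
      have hmem : AchievableBayes P μ A B d Δ (sInf T) := by
        refine ⟨le_csInf hne fun R hR => hR.1, fun ε hε => ?_⟩
        obtain ⟨R, hR, hlt⟩ := exists_lt_of_csInf_lt hne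
          (show sInf T < sInf T + ε / 2 by linarith)
        filter_upwards [hR.2 (ε / 2) (half_pos hε)] with n ⟨c, hc, hd⟩
        exact ⟨c, by linarith, by linarith⟩
      have heq : usrdfBayes P μ A B d Δ = (sInf T : ℝ) :=
        le_antisymm (iInf₂_le _ hmem)
          (le_iInf₂ fun R hR => by exact_mod_cast csInf_le hbdd hR)
      obtain ⟨W, hW, hI, hd⟩ := exists_channels_of_achievableBayes A hP hP1 hμ d hmem
      -- The minimizing split is the distortion that the limiting channel spends at each atom.
      refine ⟨fun s => atomDistortion P μ A d s (W s), hd, le_antisymm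
        (usrdfBayes_le_iSup A hP hP1 hμ d hμ1 hd) ?_⟩
      rw [heq]
      refine iSup_le fun s => (rhoBayes_le A hP hP1 hμ d hμ1 (hW s) le_rfl).trans ?_
      exact_mod_cast hI s
    -- With no achievable rate, every admissible split has value `⊤`; the constant split at `Δ`
    -- shows that one exists.
    · push Not at hne
      have htop : usrdfBayes P μ A B d Δ = ⊤ := by simp [usrdfBayes, hne]
      have hD : expect (atomPmf P μ A) (fun _ => Δ) ≤ Δ := by
        classical
        rw [expect_atomPmf_of_mul P μ A (f := fun τ => μ τ * Δ), ← Finset.sum_mul, hμ1, one_mul]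
        intro s
        rw [atomPmf_eq, Finset.sum_mul]
        simp only [ite_mul, zero_mul]
      refine ⟨fun _ => Δ, hD, ?_⟩
      rw [htop, eq_comm, ← top_le_iff, ← htop]
      exact usrdfBayes_le_iSup A hP hP1 hμ d hμ1 hD
  · rintro v ⟨D, hD, rfl⟩
    exact usrdfBayes_le_iSup A hP hP1 hμ d hμ1 hD

end Bayes

/-! ### The nonBayesian setting -/

section Peak

variable {m : ℕ} {X Y : Fin m → Type*} {Θ : Type*}
variable [∀ i, Fintype (X i)] [∀ i, Fintype (Y i)] {P : Θ → (∀ i, X i) → ℝ}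
variable (A : Finset (Fin m)) (hP : ∀ τ x, 0 < P τ x) (hP1 : ∀ τ, ∑ x, P τ x = 1)
variable {B : Finset (Fin m)} (d : Sub X B → Sub Y B → ℝ)

include hP hP1

theorem exists_mem_kappaPeak_rhoPeak_eq {δ : ℝ} {s : Atom P A}
    (hne : (kappaPeak P A B d δ s).Nonempty) :
    ∃ W ∈ kappaPeak P A B d δ s, rhoPeak P A B d δ s = (infoPeak P A B s W : EReal) := by
  obtain ⟨W₀, hW₀, hd₀⟩ := hne
  obtain ⟨W, hW, hd, hmin⟩ := exists_infoPeak_min A hP hP1 s (ι := Lam P A s)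
    (F := fun τ => chanDistortion d (P τ)) (fun τ => continuous_chanDistortion d (P τ)) (δ := δ)
    ⟨W₀, hW₀, fun τ => hd₀ τ τ.2⟩
  have hmem : W ∈ kappaPeak P A B d δ s := ⟨hW, fun τ hτ => hd ⟨τ, hτ⟩⟩
  refine ⟨W, hmem, le_antisymm (iInf₂_le W hmem) (le_iInf₂ fun W' hW' => ?_)⟩
  exact_mod_cast hmin W' hW'.1 fun τ => hW'.2 τ τ.2

theorem rhoPeak_le_of_achievablePeak {R Δ : ℝ} (h : AchievablePeak P A B d Δ R) (s : Atom P A) :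
    rhoPeak P A B d Δ s ≤ R := by
  -- Here `none` is the rate constraint and `some τ` the distortion under `τ`. The peak criterion
  -- lets each atom be treated separately.
  let F : Option (Lam P A s) → (Sub X A → Sub Y B → ℝ) → ℝ := fun i W =>
    i.elim (infoPeak P A B s W) fun τ => chanDistortion d (P τ) W
  obtain ⟨W, hW, hF⟩ := exists_forall_le_of_forall_pos isCompact_channel (F := F)
    (c := fun i => i.elim R fun _ => Δ) (by
      rintro (_ | τ)
      · exact continuousOn_infoPeak A hP hP1 s
      · exact (continuous_chanDistortion d (P τ)).continuousOn) (by
      intro ε hε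
      obtain ⟨n, ⟨c, hc, hcd⟩, hn⟩ := ((h.2 ε hε).and (eventually_gt_atTop 0)).exists
      obtain ⟨W, hW, hI, hd⟩ := exists_channel_of_fsCode A hP hP1 d hn c s
      refine ⟨W, hW, ?_⟩
      rintro (_ | τ)
      · exact hI.trans hc.le
      · exact (hd τ τ.2).trans_le (hcd τ))
  have hmem : W ∈ kappaPeak P A B d Δ s := ⟨hW, fun τ hτ => hF (some ⟨τ, hτ⟩)⟩
  refine (iInf₂_le W hmem).trans ?_
  exact_mod_cast hF none

theorem usrdfPeak_eq_iSup [Fintype Θ] [Nonempty Θ] (Δ : ℝ) :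
    usrdfPeak P A B d Δ = ⨆ s, rhoPeak P A B d Δ s := by
  refine le_antisymm ?_ (le_iInf₂ fun R hR => iSup_le fun s =>
    rhoPeak_le_of_achievablePeak A hP hP1 d hR s)
  by_cases htop : ∀ s, (kappaPeak P A B d Δ s).Nonempty
  · choose W hW hrho using fun s => exists_mem_kappaPeak_rhoPeak_eq A hP hP1 d (htop s)
    have : Nonempty (Atom P A) := Nonempty.map (atomOf P A) inferInstance
    obtain ⟨s₀, hs₀⟩ := Finite.exists_max fun s => infoPeak P A B s (W s)
    have hR0 := infoPeak_nonneg A hP hP1 s₀ (hW s₀).1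
    have hach : AchievablePeak P A B d Δ (infoPeak P A B s₀ (W s₀)) := by
      refine ⟨hR0, fun ε hε => ?_⟩
      filter_upwards [eventually_exists_fsCode A hP hP1 d (fun s => (hW s).1) hR0 hs₀ hε]
        with n ⟨c, hc, hd⟩
      exact ⟨c, hc, fun τ => (hd τ).trans (add_le_add_left ((hW _).2 τ rfl) ε)⟩
    refine (iInf₂_le _ hach).trans ?_
    rw [← hrho s₀]
    exact le_iSup (fun s => rhoPeak P A B d Δ s) s₀
  · push Not at htop
    obtain ⟨s, hs⟩ := htop
    refine le_top.trans (le_of_eq_of_le ?_ (le_iSup (fun s => rhoPeak P A B d Δ s) s))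
    simp [rhoPeak, hs]

omit hP hP1 in
theorem exists_isLeast_worstDistortion [Finite Θ] [∀ i, Nonempty (Y i)] (s : Atom P A) :
    ∃ W ∈ channels X Y A B, IsLeast (worstDistortion P A B d s '' channels X Y A B)
      (worstDistortion P A B d s W) := by
  classical
  have : Fintype (Lam P A s) := Fintype.ofFinite _
  have : Nonempty (Lam P A s) := by
    obtain ⟨τ, hτ⟩ := atomOf_surjective P A s
    exact ⟨⟨τ, hτ⟩⟩
  have hc : Continuous (worstDistortion P A B d s) := by
    -- As a maximum over the finite nonempty atom, the worst distortion inherits continuity, and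
    -- compactness gives a minimizer.
    have : worstDistortion P A B d s = fun W => Finset.univ.sup' Finset.univ_nonempty
        fun τ : Lam P A s => chanDistortion d (P τ) W := by
      funext W
      exact (Finset.sup'_univ_eq_ciSup _).symm
    rw [this]
    exact Continuous.finset_sup'_apply _ fun τ _ => continuous_chanDistortion d (P τ)
  have hne : (channels X Y A B).Nonempty :=
    ⟨fun _ => Pi.single (Classical.arbitrary _) 1, fun _ => single_mem_stdSimplex ℝ _⟩
  obtain ⟨W, hW, hmin⟩ := (isCompact_channel (U := Sub X A) (V := Sub Y B)).exists_isMinOn hne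
    hc.continuousOn
  refine ⟨W, hW, Set.mem_image_of_mem _ hW, ?_⟩
  rintro _ ⟨W', hW', rfl⟩
  exact hmin hW'

end Peak

end USRD

/-! ### The main theorem -/

theorem theorem1 {m : ℕ} {X Y : Fin m → Type*} {Θ : Type*}
    [∀ i, Fintype (X i)] [∀ i, Fintype (Y i)] [∀ i, Nonempty (Y i)]
    [Fintype Θ] [Nonempty Θ]
    (P : Θ → (∀ i, X i) → ℝ) (hP : ∀ τ x, 0 < P τ x) (hP1 : ∀ τ, ∑ x, P τ x = 1)
    (A B : Finset (Fin m))
    (d : USRD.Sub X B → USRD.Sub Y B → ℝ) (hd : ∀ x y, 0 ≤ d x y) :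
    -- Bayesian setting
    (∀ μ : Θ → ℝ, (∀ τ, 0 < μ τ) → ∑ τ, μ τ = 1 →
      (∀ Δ : ℝ, USRD.deltaMinBayes P μ A B d ≤ Δ → Δ ≤ USRD.deltaMaxBayes P μ A B d →
        IsLeast
          {v : EReal | ∃ D : USRD.Atom P A → ℝ, USRD.expect (USRD.atomPmf P μ A) D ≤ Δ ∧
            v = ⨆ τ₁, USRD.rhoBayes P μ A B d (D τ₁) τ₁}
          (USRD.usrdfBayes P μ A B d Δ)) ∧
      -- the minimum defining `ρ_A^B` exists
      (∀ (δ : ℝ) (τ₁ : USRD.Atom P A), (USRD.kappaBayes P μ A B d δ τ₁).Nonempty →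
        ∃ Q ∈ USRD.kappaBayes P μ A B d δ τ₁,
          USRD.rhoBayes P μ A B d δ τ₁ = (USRD.infoBayes P A B τ₁ Q : EReal)) ∧
      -- the second expression for `Δ_min`
      USRD.deltaMinBayes P μ A B d =
        USRD.expect (USRD.source P μ) (fun ω =>
          ⨅ y, USRD.dAtom P μ A B d (USRD.atomOf P A ω.1) (A.restrict ω.2) y)) ∧
    -- nonBayesian setting
    (∀ Δ : ℝ, USRD.deltaMinPeak P A B d ≤ Δ → Δ ≤ USRD.deltaMaxPeak P A B d →
      USRD.usrdfPeak P A B d Δ = ⨆ τ₁, USRD.rhoPeak P A B d Δ τ₁) ∧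
    -- the minimum defining `ρ_A^{nB}` exists
    (∀ (δ : ℝ) (τ₁ : USRD.Atom P A), (USRD.kappaPeak P A B d δ τ₁).Nonempty →
      ∃ W ∈ USRD.kappaPeak P A B d δ τ₁,
        USRD.rhoPeak P A B d δ τ₁ = (USRD.infoPeak P A B τ₁ W : EReal)) ∧
    -- the minimum over conditional pmfs in `Δ_min` exists
    (∀ τ₁ : USRD.Atom P A, ∃ W ∈ USRD.channels X Y A B,
      IsLeast (USRD.worstDistortion P A B d τ₁ '' USRD.channels X Y A B)
        (USRD.worstDistortion P A B d τ₁ W)) := by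
  refine ⟨fun μ hμ hμ1 => ⟨fun Δ _ _ => ?_, fun δ τ₁ hne => ?_, ?_⟩, fun Δ _ _ => ?_,
    fun δ τ₁ hne => ?_, fun τ₁ => ?_⟩
  · exact USRD.isLeast_usrdfBayes A hP hP1 hμ d hμ1 Δ
  · obtain ⟨W, hW, hd', hrho⟩ := USRD.exists_channel_rhoBayes_eq A hP hP1 hμ d hμ1 hne
    exact ⟨_, USRD.jointOfChannel_mem_kappaBayes A hP hP1 hμ d hμ1 hW hd',
      hrho.trans (by rw [USRD.infoBayes_jointOfChannel A hP1 hμ hW])⟩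
  · exact USRD.deltaMinBayes_eq A hP1 hμ d
  · exact USRD.usrdfPeak_eq_iSup A hP hP1 d Δ
  · exact USRD.exists_mem_kappaPeak_rhoPeak_eq A hP hP1 d hne
  · exact USRD.exists_isLeast_worstDistortion A d τ₁
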